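/- Let $6\le n\le 8$ and let $G=E_n\subset O(\mathbb R^n)$ be the (essential, finite) real reflection group of type $E_n$, i.e. the group generated by the reflections in a basis of unit vectors $\alpha_1,\dots,\alpha_n$ of $\mathbb R^n$ with $\langle\alpha_i,\alpha_j\rangle=-\cos(\pi/m_{ij})$, where $(m_{ij})$ is the Coxeter matrix of type $E_n$. A set of basic invariants of $G$ is a family of algebraically independent homogeneous polynomials $\pi_1,\dots,\pi_n$ with $\deg\pi_1\le\dots\le\deg\pi_n$ that generate the ring $\mathbb R[x_1,\dots,x_n]^G$ of $G$-invariant polynomials. A $G$-invariant real variety $X\subseteq\mathbb R^n$ is called $k$-sparse if, for some choice of basic invariants $\pi_1,\dots,\pi_n$, there are finitely many $f_1,\dots,f_m\in\mathbb R[\pi_1,\dots,\pi_k]$ with $X=\{p\in\mathbb R^n: f_1(p)=\dots=f_m(p)=0\}$. A flat of $G$ is an intersection of a set of hyperplanes of reflections belonging to $G$ (the empty intersection being $\mathbb R^n$), and $\mathcal H_i(G)$ denotes the set of points that lie in some flat of dimension $i$. Then every nonempty $2$-sparse $E_n$-invariant real variety $X$ satisfies $X\cap\mathcal H_{n-2}(E_n)\ne\emptyset$.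 -/

import Mathlib

open scoped RealInnerProductSpace

/-- Euclidean `n`-space `V = ℝⁿ`. -/
abbrev EucSpace (n : ℕ) : Type := EuclideanSpace ℝ (Fin n)

/-- The orthogonal group `O(V)` of linear isometries of `V = ℝⁿ`. -/
abbrev OrthGroup (n : ℕ) : Type := EucSpace n ≃ₗᵢ[ℝ] EucSpace n

/-- The linear hyperplane orthogonal to `v` (a hyperplane when `v ≠ 0`). -/
noncomputable abbrev hyperplaneOf {n : ℕ} (v : EucSpace n) : Submodule ℝ (EucSpace n) := (ℝ ∙ v)ᗮ

/-- The orthogonal reflection fixing the hyperplane `v^⊥` pointwise and sending `v` to `-v`. -/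
noncomputable def reflectionAlong {n : ℕ} (v : EucSpace n) : OrthGroup n :=
  (hyperplaneOf v).reflection

/-- `G ⊆ O(ℝⁿ)` is the essential reflection group with Coxeter matrix `M`: it is generated by the
reflections in a system of simple roots, that is, a basis of unit vectors `α i` of `ℝⁿ` with
`⟪α i, α j⟫ = -cos (π / M i j)`.  (On the diagonal, `M i i = 1` gives `⟪α i, α i⟫ = 1`.) -/
def IsOfCoxeterType {n : ℕ} (M : CoxeterMatrix (Fin n)) (G : Subgroup (OrthGroup n)) : Prop :=
  ∃ α : Fin n → EucSpace n,
    LinearIndependent ℝ α ∧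
    (∀ i j, ⟪α i, α j⟫ = -Real.cos (Real.pi / (M i j : ℝ))) ∧
    G = Subgroup.closure (Set.range fun i => reflectionAlong (α i))

/-- `G ⊆ O(ℝⁿ)` is the reflection group of type `E_n` (which exists for `n = 6, 7, 8` only). -/
def IsTypeE : {n : ℕ} → Subgroup (OrthGroup n) → Prop
  | 6, G => IsOfCoxeterType CoxeterMatrix.E₆ G
  | 7, G => IsOfCoxeterType CoxeterMatrix.E₇ G
  | 8, G => IsOfCoxeterType CoxeterMatrix.E₈ G
  | _, _ => False

/-- The reflection arrangement `ℋ(G)`: the hyperplanes of all reflections belonging to `G`. -/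
def reflectionArrangement {n : ℕ} (G : Subgroup (OrthGroup n)) :
    Set (Submodule ℝ (EucSpace n)) :=
  {H | ∃ v : EucSpace n, v ≠ 0 ∧ reflectionAlong v ∈ G ∧ H = hyperplaneOf v}

/-- The flats of the arrangement: all intersections of hyperplanes in `ℋ(G)`; the empty
intersection is the whole space. -/
def arrangementFlats {n : ℕ} (G : Subgroup (OrthGroup n)) : Set (Submodule ℝ (EucSpace n)) :=
  {L | ∃ A : Set (Submodule ℝ (EucSpace n)), A ⊆ reflectionArrangement G ∧ L = sInf A}

/-- The stratum `ℋ_i(G)`: the points that lie in some flat of dimension `i`. -/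
def stratum {n : ℕ} (G : Subgroup (OrthGroup n)) (i : ℕ) : Set (EucSpace n) :=
  {p | ∃ L ∈ arrangementFlats G, Module.finrank ℝ L = i ∧ p ∈ L}

/-- The value of the polynomial `f` at the point `p` of `ℝⁿ`. -/
noncomputable def evalAt {n : ℕ} (p : EucSpace n) (f : MvPolynomial (Fin n) ℝ) : ℝ :=
  MvPolynomial.eval (fun i => p i) f

/-- The real variety `V_ℝ(f₁, …, f_m)`. -/
def realVariety {n m : ℕ} (f : Fin m → MvPolynomial (Fin n) ℝ) : Set (EucSpace n) :=
  {p | ∀ j, evalAt p (f j) = 0}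

/-- The ring `ℝ[V]^G` of polynomials invariant under `G`.  A real polynomial is determined by the
function it defines, so invariance is expressed through values. -/
def invariantRing {n : ℕ} (G : Subgroup (OrthGroup n)) :
    Subalgebra ℝ (MvPolynomial (Fin n) ℝ) where
  carrier := {f | ∀ g ∈ G, ∀ p : EucSpace n, evalAt (g p) f = evalAt p f}
  mul_mem' := by
    intro a b ha hb g hg p
    have h1 := ha g hg p
    have h2 := hb g hg p
    simp only [evalAt, map_mul] at *
    rw [h1, h2]
  add_mem' := by
    intro a b ha hb g hg p
    have h1 := ha g hg p
    have h2 := hb g hg p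
    simp only [evalAt, map_add] at *
    rw [h1, h2]
  algebraMap_mem' := by
    intro r g _ p
    simp [evalAt, MvPolynomial.algebraMap_eq]

/-- `π₁, …, π_n` (indexed by `Fin n`, starting from `0`) is a set of basic invariants for `G`:
algebraically independent homogeneous generators of `ℝ[V]^G`, labelled by increasing degree. -/
structure IsBasicInvariants {n : ℕ} (G : Subgroup (OrthGroup n))
    (π : Fin n → MvPolynomial (Fin n) ℝ) : Prop where
  homogeneous : ∀ i, (π i).IsHomogeneous (π i).totalDegree
  algebraicIndependent : AlgebraicIndependent ℝ π
  adjoin_eq : Algebra.adjoin ℝ (Set.range π) = invariantRing G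
  monotone_degree : Monotone fun i => (π i).totalDegree

/-- `X` is a `k`-sparse (`G`-invariant) real variety: `X = V_ℝ(f₁, …, f_m)` with
`f₁, …, f_m ∈ ℝ[π₁, …, π_k]` for some choice of basic invariants.  Such an `X` is automatically
`G`-invariant. -/
def IsSparse {n : ℕ} (G : Subgroup (OrthGroup n)) (k : ℕ) (X : Set (EucSpace n)) : Prop :=
  ∃ π : Fin n → MvPolynomial (Fin n) ℝ, IsBasicInvariants G π ∧
    ∃ (m : ℕ) (f : Fin m → MvPolynomial (Fin n) ℝ),
      (∀ j, f j ∈ Algebra.adjoin ℝ (π '' {i : Fin n | (i : ℕ) < k})) ∧ X = realVariety f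

/-!
Through every point of `X` there is an affine slice in the directions of an orthonormal family
`e₁, …, e_{n-1}` for which all `e_i ± e_j` are roots of `E_n`, so that invariants of `E_n` restrict
to invariants of type `D_{n-1}` on the slice. The first two basic invariants have so small a degree
that their restrictions depend only on the product of the coordinates and on the first few even
power sums. On the compact set where these quantities are prescribed, the next even power sum has a
maximum. By Lagrange's condition the squares of the coordinates take so few values there that two
independent roots of type `D_{n-1}` vanish at the maximizer. This point lies in `X` and in a flat of
codimension two.

The bound on the degree of the second basic invariant follows by averaging over `E_n` a polynomial
of degree `5`, `6` or `8` whose average is not constant on some sphere. The averages at two points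
`x` and `y` of equal norm are told apart because the coordinates of the orbit of `x` are restricted
by the root lattice.
-/

section AffinePullback

open MvPolynomial

variable {σ τ : Type*}

theorem totalDegree_aeval_le_of_totalDegree_le_one {R : Type*} [CommSemiring R]
    (f : MvPolynomial σ R) {g : σ → MvPolynomial τ R} (hg : ∀ i, (g i).totalDegree ≤ 1) :
    (aeval g f).totalDegree ≤ f.totalDegree := by
  rw [aeval_def, eval₂_eq]
  refine totalDegree_finsetSum_le fun s hs => (totalDegree_mul _ _).trans ?_
  rw [algebraMap_eq, totalDegree_C, zero_add]
  refine (totalDegree_finsetProd _ _).trans (le_trans (Finset.sum_le_sum fun i _ => ?_)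
    (le_totalDegree hs))
  exact (totalDegree_pow _ _).trans ((Nat.mul_le_mul_left _ (hg i)).trans (mul_one _).le)

variable [Fintype τ] [DecidableEq τ]

/-- The pullback `f ∘ A` of a polynomial function `f` along an affine map `A`. -/
noncomputable def affinePullback (A : EuclideanSpace ℝ τ →ᵃ[ℝ] EuclideanSpace ℝ σ)
    (f : MvPolynomial σ ℝ) : MvPolynomial τ ℝ :=
  aeval (fun j => C (A 0 j) + ∑ i, C (A.linear (EuclideanSpace.single i 1) j) * X i) f

theorem eval_affinePullback (A : EuclideanSpace ℝ τ →ᵃ[ℝ] EuclideanSpace ℝ σ)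
    (f : MvPolynomial σ ℝ) (y : EuclideanSpace ℝ τ) :
    eval y.ofLp (affinePullback A f) = eval (A y).ofLp f := by
  have hA (j : σ) : A y j = A 0 j + ∑ i, A.linear (EuclideanSpace.single i 1) j * y i := by
    have hy : A y = A.linear y + A 0 := by simpa using A.map_vadd 0 y
    have hlin : A.linear y = ∑ i, y i • A.linear (EuclideanSpace.single i 1) := by
      conv_lhs => rw [← (EuclideanSpace.basisFun τ ℝ).sum_repr y]
      simp
    simp [hy, hlin, add_comm, mul_comm]
  rw [affinePullback, ← coe_aeval_eq_eval, ← coe_aeval_eq_eval, RingHom.coe_coe, RingHom.coe_coe,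
    ← AlgHom.comp_apply, comp_aeval]
  congr 2
  funext j
  simp [hA]

theorem totalDegree_affinePullback_le (A : EuclideanSpace ℝ τ →ᵃ[ℝ] EuclideanSpace ℝ σ)
    (f : MvPolynomial σ ℝ) : (affinePullback A f).totalDegree ≤ f.totalDegree :=
  totalDegree_aeval_le_of_totalDegree_le_one f fun _ =>
    (totalDegree_add _ _).trans <| max_le (by simp) <| totalDegree_finsetSum_le fun i _ =>
      (totalDegree_mul _ _).trans (by simp)

end AffinePullback

section SymmetricSums

variable {σ : Type*} [Fintype σ] [DecidableEq σ]

/-- The symmetrization `∑_π ∏ i, t (π i) ^ b i` of the monomial with exponent vector `b`. -/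
def monomialSum (b : σ → ℕ) (t : σ → ℝ) : ℝ := ∑ π : Equiv.Perm σ, ∏ i, t (π i) ^ b i

theorem monomialSum_comp_perm (b : σ → ℕ) (τ : Equiv.Perm σ) (t : σ → ℝ) :
    monomialSum (b ∘ τ) t = monomialSum b t := by
  unfold monomialSum
  rw [← Equiv.sum_comp (Equiv.mulRight τ)]
  exact Finset.sum_congr rfl fun π _ => Equiv.prod_comp τ fun i => t (π i) ^ b i

theorem powerSum_mul_monomialSum (b : σ → ℕ) (c : ℕ) (t : σ → ℝ) :
    (∑ l, t l ^ c) * monomialSum b t = ∑ l, monomialSum (b + Pi.single l c) t := by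
  unfold monomialSum
  rw [Finset.sum_comm, Finset.mul_sum]
  refine Finset.sum_congr rfl fun π _ => ?_
  rw [← Equiv.sum_comp π, Finset.sum_mul]
  refine Finset.sum_congr rfl fun l _ => ?_
  have hsingle : ∏ i, t (π i) ^ (Pi.single l c : σ → ℕ) i = t (π l) ^ c := by
    rw [Finset.prod_eq_single_of_mem l (Finset.mem_univ l) fun i _ hi => by
      rw [Pi.single_eq_of_ne hi, pow_zero], Pi.single_eq_same]
  simp only [Pi.add_apply, pow_add, Finset.prod_mul_distrib, hsingle]
  exact mul_comm _ _

theorem monomialSum_add_single_eq_of_apply_eq_zero {b : σ → ℕ} {i j : σ} (hi : b i = 0)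
    (hj : b j = 0) (c : ℕ) (t : σ → ℝ) :
    monomialSum (b + Pi.single i c) t = monomialSum (b + Pi.single j c) t := by
  refine Eq.trans (congrArg (monomialSum · t) ?_) (monomialSum_comp_perm _ (Equiv.swap i j) t)
  ext l
  rcases eq_or_ne l i with rfl | hli
  · simp [hi, hj]
  rcases eq_or_ne l j with rfl | hlj
  · simp [hi, hj, hli, hli.symm]
  · simp [Equiv.swap_apply_of_ne_of_ne hli hlj, hli, hlj]

theorem card_mul_monomialSum_add_single {b : σ → ℕ} {j : σ} (hj : b j = 0) (c : ℕ) (t : σ → ℝ) :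
    (Finset.univ.filter (b · = 0)).card * monomialSum (b + Pi.single j c) t =
      (∑ l, t l ^ c) * monomialSum b t -
        ∑ l with b l ≠ 0, monomialSum (b + Pi.single l c) t := by
  rw [powerSum_mul_monomialSum, ← Finset.sum_filter_add_sum_filter_not _ (b · = 0),
    add_sub_cancel_right, ← nsmul_eq_mul]
  refine (Finset.sum_eq_card_nsmul fun l hl => ?_).symm
  exact monomialSum_add_single_eq_of_apply_eq_zero (Finset.mem_filter.mp hl).2 hj c t

theorem exists_eq_add_single (b : σ → ℕ) {i : σ} (hi : b i ≠ 0) :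
    ∃ b' : σ → ℕ, b = b' + Pi.single i (b i) ∧ b' i = 0 ∧
      Finset.univ.filter (b' · ≠ 0) ⊂ Finset.univ.filter (b · ≠ 0) := by
  refine ⟨Function.update b i 0, ?_, Function.update_self .., ?_⟩
  · ext l
    rcases eq_or_ne l i with rfl | hl <;> simp [*]
  · refine Finset.ssubset_iff_subset_ne.mpr ⟨fun l hl => ?_, fun heq => ?_⟩
    · rcases eq_or_ne l i with rfl | hne
      · simpa using hi
      · simpa [hne] using hl
    · simpa [hi] using Finset.ext_iff.mp heq i

/-- Induction on the number of variables occurring in the monomial: multiplying the symmetrized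
monomial without the variable `i` by the power sum of degree `b i` produces `monomialSum b` and
symmetrized monomials in fewer variables. -/
theorem monomialSum_eq_of_powerSum_eq {k : ℕ} {t t' : σ → ℝ}
    (h : ∀ i, 1 ≤ i → i ≤ k → ∑ l, t l ^ i = ∑ l, t' l ^ i) (b : σ → ℕ) (hb : ∑ i, b i ≤ k) :
    monomialSum b t = monomialSum b t' := by
  induction hN : (Finset.univ.filter (b · ≠ 0)).card using Nat.strong_induction_on
    generalizing b with
  | _ N ih =>
  by_cases hb0 : ∀ i, b i = 0
  · simp [monomialSum, hb0]
  push Not at hb0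
  obtain ⟨i, hi⟩ := hb0
  obtain ⟨b', hb', hb'i, hsupp⟩ := exists_eq_add_single b hi
  have hcard := hN ▸ Finset.card_lt_card hsupp
  have hsum (l : σ) : ∑ j, (b' + Pi.single l (b i) : σ → ℕ) j = ∑ j, b j := by
    conv_rhs => rw [hb']
    simp only [Pi.add_apply, Finset.sum_add_distrib, Finset.sum_pi_single', Finset.mem_univ,
      if_true]
  have hM : monomialSum b' t = monomialSum b' t' := by
    refine ih _ hcard b' (le_trans (Finset.sum_le_sum fun l _ => ?_) ((hsum i).trans_le hb)) rfl
    exact Nat.le_add_right _ _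
  have hMl : ∀ l ∈ Finset.univ.filter (b' · ≠ 0),
      monomialSum (b' + Pi.single l (b i)) t = monomialSum (b' + Pi.single l (b i)) t' := by
    refine fun l hl => ih _ ((Finset.card_le_card fun j hj => ?_).trans_lt hcard) _
      ((hsum l).trans_le hb) rfl
    rcases eq_or_ne j l with rfl | hjl
    · exact hl
    · simpa [hjl] using hj
  have hpow := h (b i) (Nat.one_le_iff_ne_zero.mpr hi)
    ((Finset.single_le_sum (fun l _ => Nat.zero_le (b l)) (Finset.mem_univ i)).trans hb)
  have hne : ((Finset.univ.filter (b' · = 0)).card : ℝ) ≠ 0 :=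
    Nat.cast_ne_zero.mpr (Finset.card_ne_zero_of_mem (a := i) (by simpa using hb'i))
  refine mul_left_cancel₀ hne ?_
  rw [hb', card_mul_monomialSum_add_single hb'i, card_mul_monomialSum_add_single hb'i, hpow, hM,
    Finset.sum_congr rfl hMl]

end SymmetricSums

section InvariantD

open MvPolynomial

variable {σ : Type*} [DecidableEq σ]

/-- The point with the signs of its `i`-th and `j`-th coordinates changed. -/
def negPair (i j : σ) (x : σ → ℝ) : σ → ℝ := fun l => if l = i ∨ l = j then -x l else x l

theorem prod_negPair_pow [Fintype σ] {i j : σ} (hij : i ≠ j) (x : σ → ℝ) (s : σ → ℕ) :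
    ∏ l, negPair i j x l ^ s l = (-1) ^ (s i + s j) * ∏ l, x l ^ s l := by
  have h (l : σ) : negPair i j x l ^ s l =
      ((if l = i then (-1) ^ s i else 1) * (if l = j then (-1) ^ s j else 1)) * x l ^ s l := by
    unfold negPair
    rcases eq_or_ne l i with rfl | hi
    · simp [hij, ← mul_pow]
    · rcases eq_or_ne l j with rfl | hj
      · simp [hi, ← mul_pow]
      · simp [hi, hj]
  simp only [h, Finset.prod_mul_distrib, Finset.prod_ite_eq', Finset.mem_univ, if_true, pow_add]

theorem exponents_mod_two_eq [Finite σ] {g : MvPolynomial σ ℝ} {i j : σ} (hij : i ≠ j)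
    (h : ∀ x, eval (negPair i j x) g = eval x g) {s : σ →₀ ℕ} (hs : s ∈ g.support) :
    s i % 2 = s j % 2 := by
  cases nonempty_fintype σ
  set g' : MvPolynomial σ ℝ :=
    ∑ s ∈ g.support, monomial s ((-1) ^ (s i + s j) * g.coeff s) with hg'
  have hgg' : g' = g := by
    refine MvPolynomial.funext fun x => ?_
    rw [← h x, hg', map_sum, eval_eq' (negPair i j x)]
    refine Finset.sum_congr rfl fun s _ => ?_
    rw [prod_negPair_pow hij, eval_monomial, Finsupp.prod_fintype _ _ fun _ => pow_zero _]
    ring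
  have hc : (-1) ^ (s i + s j) * g.coeff s = g.coeff s := by
    conv_rhs => rw [← hgg', hg', coeff_sum]
    simp only [coeff_monomial]
    rw [Finset.sum_ite_eq' g.support s, if_pos hs]
  have hsign : (-1 : ℝ) ^ (s i + s j) = 1 :=
    mul_right_cancel₀ (mem_support_iff.mp hs) (by rw [hc, one_mul])
  rw [neg_one_pow_eq_one_iff_even (by norm_num), Nat.even_iff] at hsign
  omega

/-- Invariance under the reflection group of type `D`, which permutes the coordinates and changes
an even number of signs. -/
structure IsInvariantD (g : MvPolynomial σ ℝ) : Prop where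
  swap : ∀ i j, i ≠ j → ∀ x : σ → ℝ, eval (x ∘ Equiv.swap i j) g = eval x g
  negPair : ∀ i j, i ≠ j → ∀ x : σ → ℝ, eval (negPair i j x) g = eval x g

namespace IsInvariantD

variable {g : MvPolynomial σ ℝ}

theorem eval_comp_perm [Finite σ] (hg : IsInvariantD g) (π : Equiv.Perm σ) (x : σ → ℝ) :
    eval (x ∘ π) g = eval x g := by
  induction π using Equiv.Perm.swap_induction_on generalizing x with
  | one => rfl
  | swap_mul f i j hij ih => rw [Equiv.Perm.coe_mul, ← Function.comp_assoc, ih, hg.swap i j hij]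

theorem card_perm_mul_eval [Fintype σ] (hg : IsInvariantD g) (x : σ → ℝ) :
    (Fintype.card (Equiv.Perm σ) : ℝ) * eval x g =
      ∑ s ∈ g.support, g.coeff s * monomialSum s x := by
  have havg : ∑ π : Equiv.Perm σ, eval (x ∘ π) g =
      (Fintype.card (Equiv.Perm σ) : ℝ) * eval x g := by
    simp only [hg.eval_comp_perm, Finset.sum_const, Finset.card_univ, nsmul_eq_mul]
  rw [← havg]
  simp only [eval_eq', monomialSum, Finset.mul_sum]
  rw [Finset.sum_comm]
  rfl

end IsInvariantD

theorem monomialSum_of_mod_two_eq [Fintype σ] {s : σ → ℕ} {r : ℕ} (hs : ∀ i, s i % 2 = r)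
    (x : σ → ℝ) :
    monomialSum s x = (∏ l, x l) ^ r * monomialSum (fun i => s i / 2) fun l => x l ^ 2 := by
  unfold monomialSum
  rw [Finset.mul_sum]
  refine Finset.sum_congr rfl fun π _ => ?_
  rw [← Equiv.prod_comp π x, ← Finset.prod_pow, ← Finset.prod_mul_distrib]
  refine Finset.prod_congr rfl fun i _ => ?_
  rw [← pow_mul, ← pow_add, ← hs i, Nat.mod_add_div]

/-- The basic invariants of type `D` that have degree at most `2 * k` or equal the product of the
coordinates. -/
def basicInvariantD [Fintype σ] (k : ℕ) : Option (Fin k) → (σ → ℝ) → ℝ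
  | none, y => ∏ l, y l
  | some i, y => ∑ l, y l ^ (2 * (i + 1 : ℕ))

theorem IsInvariantD.eval_eq [Fintype σ] [Nonempty σ] {g : MvPolynomial σ ℝ}
    (hg : IsInvariantD g) {k : ℕ} (hdeg : g.totalDegree ≤ 2 * k + 1) {x x' : σ → ℝ}
    (h : ∀ o, basicInvariantD k o x = basicInvariantD k o x') :
    eval x g = eval x' g := by
  have hcard : (Fintype.card (Equiv.Perm σ) : ℝ) ≠ 0 := Nat.cast_ne_zero.mpr Fintype.card_ne_zero
  refine mul_left_cancel₀ hcard ?_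
  rw [hg.card_perm_mul_eval, hg.card_perm_mul_eval]
  refine Finset.sum_congr rfl fun s hs => congrArg _ ?_
  obtain ⟨i₀⟩ := ‹Nonempty σ›
  have hmod (i : σ) : s i % 2 = s i₀ % 2 := by
    rcases eq_or_ne i i₀ with rfl | hi
    · rfl
    · exact exponents_mod_two_eq hi (hg.negPair i i₀ hi) hs
  have hhalf : ∑ i, s i / 2 ≤ k := by
    have hs_deg : ∑ i, s i ≤ 2 * k + 1 := by
      rw [← Finsupp.sum_fintype s (fun _ a => a) fun _ => rfl]
      exact (le_totalDegree hs).trans hdeg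
    have hs_half : 2 * ∑ i, s i / 2 ≤ ∑ i, s i := by
      rw [Finset.mul_sum]
      exact Finset.sum_le_sum fun i _ => Nat.mul_div_le _ _
    omega
  rw [monomialSum_of_mod_two_eq hmod, monomialSum_of_mod_two_eq hmod,
    show ∏ l, x l = ∏ l, x' l from h none]
  refine congrArg _ (monomialSum_eq_of_powerSum_eq (fun i hi hik => ?_) _ hhalf)
  simpa only [basicInvariantD, Nat.sub_add_cancel hi, pow_mul] using h (some ⟨i - 1, by omega⟩)

/-- The roots `e_i ± e_j` of the root system of type `D`, up to sign, in coordinates. -/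
def IsRootD (r : σ → ℝ) : Prop :=
  ∃ i j, i ≠ j ∧ (r = Pi.single i 1 - Pi.single j 1 ∨ r = Pi.single i 1 + Pi.single j 1)

theorem IsRootD.dotProduct_self [Fintype σ] {r : σ → ℝ} (hr : IsRootD r) : r ⬝ᵥ r = 2 := by
  obtain ⟨i, j, hij, rfl | rfl⟩ := hr
  · simp [hij, hij.symm, one_add_one_eq_two]
  · simp [hij, hij.symm, one_add_one_eq_two]

/-- The reflection of `y` in a root `r` of squared length `2` is `y - (r ⬝ᵥ y) • r`. -/
theorem isInvariantD_of_reflection [Fintype σ] {g : MvPolynomial σ ℝ}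
    (h : ∀ r, IsRootD r → ∀ y : σ → ℝ, eval (y - (r ⬝ᵥ y) • r) g = eval y g) :
    IsInvariantD g := by
  have hswap : ∀ i j, i ≠ j → ∀ x : σ → ℝ, eval (x ∘ Equiv.swap i j) g = eval x g := by
    refine fun i j hij x => Eq.trans (congrArg (eval · g) ?_) (h _ ⟨i, j, hij, .inl rfl⟩ x)
    ext l
    rcases eq_or_ne l i with rfl | hi
    · simp [sub_dotProduct, hij]
    · rcases eq_or_ne l j with rfl | hj
      · simp [sub_dotProduct, hi]
      · simp [Equiv.swap_apply_of_ne_of_ne hi hj, hi, hj]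
  refine ⟨hswap, fun i j hij x => Eq.trans ?_ (hswap i j hij x)⟩
  refine Eq.trans (congrArg (eval · g) ?_)
    (h _ ⟨i, j, hij, .inr rfl⟩ (x ∘ Equiv.swap i j))
  ext l
  rcases eq_or_ne l i with rfl | hi
  · simp [add_dotProduct, negPair, hij]
  · rcases eq_or_ne l j with rfl | hj
    · simp [add_dotProduct, negPair, hi]
    · simp [negPair, Equiv.swap_apply_of_ne_of_ne hi hj, hi, hj]

end InvariantD

section BasicInvariantD

variable {σ : Type*} [Fintype σ]

theorem continuous_basicInvariantD (k : ℕ) (o : Option (Fin k)) :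
    Continuous (basicInvariantD (σ := σ) k o) := by
  rcases o with _ | i
  · exact continuous_finsetProd _ fun l _ => continuous_apply l
  · exact continuous_finsetSum _ fun l _ => (continuous_apply l).pow _

theorem isCompact_fiber_basicInvariantD {k : ℕ} (hk : 1 ≤ k) (c : Option (Fin k) → ℝ) :
    IsCompact {y : σ → ℝ | ∀ o, basicInvariantD k o y = c o} := by
  refine Metric.isCompact_of_isClosed_isBounded ?_ ?_
  · rw [Set.ofPred_forall]
    exact isClosed_iInter fun o =>
      isClosed_eq (continuous_basicInvariantD k o) continuous_const
  · refine (Metric.isBounded_closedBall (x := (0 : σ → ℝ)) (r := 1 + c (some ⟨0, hk⟩))).subset ?_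
    intro y hy
    have hnormSq : ∑ l, y l ^ 2 = c (some ⟨0, hk⟩) := hy (some ⟨0, hk⟩)
    have hle (i : σ) : y i ^ 2 ≤ ∑ l, y l ^ 2 :=
      Finset.single_le_sum (fun l _ => sq_nonneg (y l)) (Finset.mem_univ i)
    have hnonneg : 0 ≤ ∑ l, y l ^ 2 := Finset.sum_nonneg fun l _ => sq_nonneg _
    rw [mem_closedBall_zero_iff, pi_norm_le_iff_of_nonneg (by linarith)]
    intro i
    rw [Real.norm_eq_abs, abs_le]
    constructor <;> nlinarith [hle i]

theorem hasStrictFDerivAt_sum_pow (N : ℕ) (x : σ → ℝ) :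
    HasStrictFDerivAt (fun y : σ → ℝ => ∑ l, y l ^ N)
      (∑ l, (N * x l ^ (N - 1)) • (ContinuousLinearMap.proj l : (σ → ℝ) →L[ℝ] ℝ)) x := by
  refine HasStrictFDerivAt.fun_sum fun l _ => ?_
  simpa using (hasStrictFDerivAt_apply (𝕜 := ℝ) l x).pow N

end BasicInvariantD

section Critical

variable {σ : Type*} [DecidableEq σ]

/-- The points of the union of the flats of codimension two of the arrangement of type `D`. -/
def OrthogonalToTwoRootsD [Fintype σ] (x : σ → ℝ) : Prop :=
  ∃ r : Fin 2 → σ → ℝ, LinearIndependent ℝ r ∧ ∀ a, IsRootD (r a) ∧ r a ⬝ᵥ x = 0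

theorem exists_two_coincidences {ι α : Type*} [DecidableEq α] {S : Finset ι}
    {f : ι → α} (h : (S.image f).card + 2 ≤ S.card) :
    ∃ i j i' j', i ≠ j ∧ i' ≠ j' ∧ j ≠ i' ∧ j ≠ j' ∧ f i = f j ∧ f i' = f j' := by
  classical
  obtain ⟨i, -, j, hj, hij, hf⟩ := Finset.exists_ne_map_eq_of_card_lt_of_maps_to
    (s := S) (t := S.image f) (f := f) (by omega) fun x hx => Finset.mem_image_of_mem f hx
  obtain ⟨i', hi', j', hj', hij', hf'⟩ := Finset.exists_ne_map_eq_of_card_lt_of_maps_to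
    (s := S.erase j) (t := S.image f) (f := f) (by rw [Finset.card_erase_of_mem hj]; omega)
    fun x hx => Finset.mem_image_of_mem f (Finset.mem_of_mem_erase hx)
  exact ⟨i, j, i', j', hij, hij', (Finset.ne_of_mem_erase hi').symm,
    (Finset.ne_of_mem_erase hj').symm, hf, hf'⟩

variable [Fintype σ]

theorem exists_isRootD_of_sq_eq {x : σ → ℝ} {i j : σ} (hij : i ≠ j) (h : x i ^ 2 = x j ^ 2) :
    ∃ r, IsRootD r ∧ r ⬝ᵥ x = 0 ∧ r i ≠ 0 ∧ r j ≠ 0 ∧ ∀ l, l ≠ i → l ≠ j → r l = 0 := by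
  rcases sq_eq_sq_iff_eq_or_eq_neg.mp h with h | h
  · refine ⟨Pi.single i 1 - Pi.single j 1, ⟨i, j, hij, .inl rfl⟩, ?_, ?_, ?_, fun l hi hj => ?_⟩ <;>
      simp [sub_dotProduct, hij.symm, *]
  · refine ⟨Pi.single i 1 + Pi.single j 1, ⟨i, j, hij, .inr rfl⟩, ?_, ?_, ?_, fun l hi hj => ?_⟩ <;>
      simp [add_dotProduct, hij.symm, *]

theorem orthogonalToTwoRootsD_of_card_image_sq {S : Finset σ} {x : σ → ℝ}
    (h : (S.image fun i => x i ^ 2).card + 2 ≤ S.card) : OrthogonalToTwoRootsD x := by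
  obtain ⟨i, j, i', j', hij, hij', hji', hjj', hx, hx'⟩ := exists_two_coincidences h
  obtain ⟨r, hr, hrx, -, hrj, -⟩ := exists_isRootD_of_sq_eq hij hx
  obtain ⟨r', hr', hrx', hri', -, hr0'⟩ := exists_isRootD_of_sq_eq hij' hx'
  refine ⟨![r, r'], LinearIndependent.pair_iff.mpr fun s t hst => ?_,
    Fin.forall_fin_two.mpr ⟨⟨hr, hrx⟩, hr', hrx'⟩⟩
  obtain rfl : s = 0 := by simpa [hr0' j hji' hjj', hrj] using congrFun hst j
  simpa [hri'] using congrFun hst i'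

theorem orthogonalToTwoRootsD_of_two_zeros {x : σ → ℝ} {a b : σ} (hab : a ≠ b) (ha : x a = 0)
    (hb : x b = 0) : OrthogonalToTwoRootsD x := by
  refine ⟨![Pi.single a 1 - Pi.single b 1, Pi.single a 1 + Pi.single b 1],
    LinearIndependent.pair_iff.mpr fun s t hst => ?_, Fin.forall_fin_two.mpr
      ⟨⟨⟨a, b, hab, .inl rfl⟩, ?_⟩, ⟨a, b, hab, .inr rfl⟩, ?_⟩⟩
  · have hst_a : s + t = 0 := by simpa [hab] using congrFun hst a
    have hst_b : -s + t = 0 := by simpa [hab.symm] using congrFun hst b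
    constructor <;> linarith
  · simp [sub_dotProduct, ha, hb]
  · simp [add_dotProduct, ha, hb]

theorem card_image_le_natDegree {ι R : Type*} [CommRing R] [IsDomain R] [DecidableEq R]
    {S : Finset ι} {t : ι → R} {P : Polynomial R} (hP : P ≠ 0) (h : ∀ i ∈ S, P.eval (t i) = 0) :
    (S.image t).card ≤ P.natDegree := by
  refine Polynomial.card_le_degree_of_subset_roots fun y hy => ?_
  obtain ⟨i, hi, rfl⟩ := Finset.mem_image.mp hy
  simpa [hP] using h i hi

/-- After multiplication by `x j`, the Lagrange condition says that `x j ^ 2` is a root of the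
polynomial `T * Q(T) + d * ∏ l, x l` of degree at most `k + 1`, so that the `k + 3` squares take at
most `k + 1` values. -/
theorem orthogonalToTwoRootsD_of_lagrange {k : ℕ} (hσ : Fintype.card σ = k + 3) {x : σ → ℝ}
    {Q : Polynomial ℝ} {d : ℝ} (hQ : Q.natDegree ≤ k) (hne : Q ≠ 0 ∨ d ≠ 0)
    (h : ∀ j, x j * Q.eval (x j ^ 2) + d * ∏ l ∈ Finset.univ.erase j, x l = 0) :
    OrthogonalToTwoRootsD x := by
  by_cases he : ∏ l, x l = 0
  · obtain ⟨a, -, ha⟩ := Finset.prod_eq_zero_iff.mp he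
    by_cases hb : ∃ b, a ≠ b ∧ x b = 0
    · obtain ⟨b, hab, hb⟩ := hb
      exact orthogonalToTwoRootsD_of_two_zeros hab ha hb
    push Not at hb
    have hd : d = 0 := by
      have hpa : ∏ l ∈ Finset.univ.erase a, x l ≠ 0 :=
        Finset.prod_ne_zero_iff.mpr fun l hl => hb l (Finset.ne_of_mem_erase hl).symm
      simpa [ha, hpa] using h a
    have hroot : ∀ i ∈ Finset.univ.erase a, Q.eval (x i ^ 2) = 0 := fun i hi => by
      simpa [hd, hb i (Finset.ne_of_mem_erase hi).symm] using h i
    refine orthogonalToTwoRootsD_of_card_image_sq (S := Finset.univ.erase a) ?_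
    have := card_image_le_natDegree (hne.resolve_right (not_not.mpr hd)) hroot
    rw [Finset.card_erase_of_mem (Finset.mem_univ a), Finset.card_univ]
    omega
  · set P := Polynomial.X * Q + Polynomial.C (d * ∏ l, x l) with hP
    have hP0 : P ≠ 0 := by
      intro h0
      have hd : d = 0 := by
        simpa [hP, he, Polynomial.eval_prod] using congrArg (Polynomial.eval 0) h0
      have hQ0 : Q ≠ 0 := hne.resolve_right (not_not.mpr hd)
      simp [hP, hd, hQ0] at h0
    have hdeg : P.natDegree ≤ k + 1 := by
      rw [hP, Polynomial.natDegree_add_C]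
      refine Polynomial.natDegree_mul_le.trans ?_
      rw [Polynomial.natDegree_X]
      omega
    have hroot : ∀ i ∈ Finset.univ, P.eval (x i ^ 2) = 0 := fun i _ => by
      rw [hP, ← Finset.mul_prod_erase Finset.univ x (Finset.mem_univ i)]
      simp only [Polynomial.eval_add, Polynomial.eval_mul, Polynomial.eval_X, Polynomial.eval_C]
      linear_combination x i * h i
    refine orthogonalToTwoRootsD_of_card_image_sq (S := Finset.univ) ?_
    have := card_image_le_natDegree hP0 hroot
    rw [Finset.card_univ]
    omega

theorem exists_multipliers_of_isLocalExtrOn {k : ℕ} {z : σ → ℝ}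
    (hz : IsLocalExtrOn (fun y : σ → ℝ => ∑ l, y l ^ (2 * (k + 1)))
      {y | ∀ o, basicInvariantD k o y = basicInvariantD k o z} z) :
    ∃ (d : ℝ) (c : Fin (k + 1) → ℝ), (c ≠ 0 ∨ d ≠ 0) ∧
      ∀ j, ∑ i, c i * ((2 * (i + 1) : ℕ) * z j ^ (2 * (i + 1 : ℕ) - 1)) +
        d * ∏ l ∈ Finset.univ.erase j, z l = 0 := by
  set f' : Option (Fin k) → StrongDual ℝ (σ → ℝ) := fun o =>
    o.elim (∑ i, (∏ j ∈ Finset.univ.erase i, z j) • ContinuousLinearMap.proj i)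
      fun i => ∑ l, ((2 * (i + 1) : ℕ) * z l ^ (2 * (i + 1 : ℕ) - 1)) •
        ContinuousLinearMap.proj l with hf'
  have hfd : ∀ o, HasStrictFDerivAt (basicInvariantD k o) (f' o) z := by
    rintro (_ | i)
    · exact hasStrictFDerivAt_finsetProd
    · exact hasStrictFDerivAt_sum_pow _ z
  obtain ⟨Λ, Λ₀, hΛ, hlag⟩ := hz.exists_multipliers_of_hasStrictFDerivAt hfd
    (hasStrictFDerivAt_sum_pow _ z)
  refine ⟨Λ none, Fin.snoc (fun i => Λ (some i)) Λ₀, ?_, fun j => ?_⟩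
  · by_contra! hcon
    obtain ⟨hc, hd⟩ := hcon
    refine hΛ (Prod.ext (funext ?_) ?_)
    · rintro (_ | i)
      · exact hd
      · simpa using congrFun hc i.castSucc
    · simpa using congrFun hc (Fin.last k)
  · have hj := congrArg (fun L : StrongDual ℝ (σ → ℝ) => L (Pi.single j 1)) hlag
    simp only [Fintype.sum_option, hf', Option.elim, add_apply, smul_apply, sum_apply,
      ContinuousLinearMap.proj_apply, smul_eq_mul, zero_apply, Pi.single_apply, mul_ite, mul_one,
      mul_zero, Finset.sum_ite_eq', Finset.mem_univ, if_true] at hj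
    rw [Fin.sum_univ_castSucc]
    simp only [Fin.snoc_castSucc, Fin.snoc_last, Fin.val_castSucc, Fin.val_last]
    linear_combination hj

theorem orthogonalToTwoRootsD_of_isLocalExtrOn {k : ℕ} (hσ : Fintype.card σ = k + 3) {z : σ → ℝ}
    (hz : IsLocalExtrOn (fun y : σ → ℝ => ∑ l, y l ^ (2 * (k + 1)))
      {y | ∀ o, basicInvariantD k o y = basicInvariantD k o z} z) :
    OrthogonalToTwoRootsD z := by
  obtain ⟨d, c, hcd, hlag⟩ := exists_multipliers_of_isLocalExtrOn hz
  set Q : Polynomial ℝ :=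
    ∑ i : Fin (k + 1), Polynomial.monomial i (c i * (2 * (i + 1) : ℕ)) with hQ
  have hcoeff (i : Fin (k + 1)) : Q.coeff i = c i * (2 * (i + 1) : ℕ) := by
    rw [hQ, Polynomial.finsetSum_coeff, Finset.sum_eq_single_of_mem i (Finset.mem_univ i)]
    · rw [Polynomial.coeff_monomial, if_pos rfl]
    · exact fun j _ hj => by rw [Polynomial.coeff_monomial, if_neg fun h => hj (Fin.ext h)]
  refine orthogonalToTwoRootsD_of_lagrange (Q := Q) (d := d) hσ ?_ (hcd.imp_left ?_) fun j => ?_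
  · exact Polynomial.natDegree_sum_le_of_forall_le _ _ fun i _ =>
      (Polynomial.natDegree_monomial_le _).trans (Nat.lt_succ_iff.mp i.2)
  · refine fun hc hQ0 => hc (funext fun i => ?_)
    have := hcoeff i
    rw [hQ0, Polynomial.coeff_zero, eq_comm, mul_eq_zero] at this
    exact this.resolve_right (by positivity)
  · rw [← hlag j, hQ, Polynomial.eval_finsetSum, Finset.mul_sum]
    simp only [Polynomial.eval_monomial]
    congr 1
    refine Finset.sum_congr rfl fun i _ => ?_
    have hpow : z j ^ (2 * (i + 1 : ℕ) - 1) = z j * (z j ^ 2) ^ (i : ℕ) := by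
      rw [← pow_mul, ← pow_succ']
      congr 1
    rw [hpow]
    ring

/-- On the compact fiber of the invariants of low degree through `x`, the power sum of degree
`2 * k + 2` attains its maximum. -/
theorem exists_orthogonalToTwoRootsD {k : ℕ} (hk : 1 ≤ k) (hσ : Fintype.card σ = k + 3)
    (x : σ → ℝ) :
    ∃ z : σ → ℝ, (∀ o, basicInvariantD k o z = basicInvariantD k o x) ∧
      OrthogonalToTwoRootsD z := by
  have hcont : Continuous fun y : σ → ℝ => ∑ l, y l ^ (2 * (k + 1)) :=
    continuous_finsetSum _ fun l _ => (continuous_apply l).pow _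
  obtain ⟨z, hz, hmax⟩ := (isCompact_fiber_basicInvariantD hk fun o =>
    basicInvariantD k o x).exists_isMaxOn ⟨x, fun _ => rfl⟩ hcont.continuousOn
  have hz' : ∀ o, basicInvariantD k o z = basicInvariantD k o x := hz
  refine ⟨z, hz', orthogonalToTwoRootsD_of_isLocalExtrOn hσ ?_⟩
  simp only [hz']
  exact .inr hmax.localize

end Critical

section Reflections

variable {n : ℕ} {G : Subgroup (OrthGroup n)}

theorem reflectionAlong_apply (v p : EucSpace n) :
    reflectionAlong v p = p - (2 * ⟪v, p⟫ / ⟪v, v⟫) • v := by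
  rw [reflectionAlong, Submodule.reflection_orthogonal_apply, Submodule.reflection_singleton_apply,
    real_inner_self_eq_norm_sq, neg_sub, ← Nat.cast_smul_eq_nsmul ℝ, smul_smul]
  simp [mul_div_assoc]

theorem reflectionAlong_smul {c : ℝ} (hc : c ≠ 0) (v : EucSpace n) :
    reflectionAlong (c • v) = reflectionAlong v := by
  ext1 p
  simp only [reflectionAlong_apply, inner_smul_left, inner_smul_right, smul_smul, conj_trivial]
  congr 2
  field_simp

theorem reflectionAlong_map (g : OrthGroup n) (v : EucSpace n) :
    reflectionAlong (g v) = g * reflectionAlong v * g⁻¹ := by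
  ext1 p
  change _ = g (reflectionAlong v (g.symm p))
  obtain ⟨q, rfl⟩ := g.surjective p
  simp [reflectionAlong_apply, LinearIsometryEquiv.inner_map_map]

theorem reflectionAlong_map_mem {g : OrthGroup n} (hg : g ∈ G) {v : EucSpace n}
    (hv : reflectionAlong v ∈ G) : reflectionAlong (g v) ∈ G := by
  rw [reflectionAlong_map]
  exact G.mul_mem (G.mul_mem hg hv) (G.inv_mem hg)

theorem mem_stratum_of_linearIndependent {k : ℕ} {v : Fin k → EucSpace n}
    (hv : LinearIndependent ℝ v) (hG : ∀ a, reflectionAlong (v a) ∈ G) {x : EucSpace n}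
    (hx : ∀ a, ⟪v a, x⟫ = 0) : x ∈ stratum G (n - k) := by
  refine ⟨⨅ a, hyperplaneOf (v a), ⟨Set.range fun a => hyperplaneOf (v a), ?_, rfl⟩, ?_, ?_⟩
  · rintro _ ⟨a, rfl⟩
    exact ⟨v a, hv.ne_zero a, hG a, rfl⟩
  · have hperp : ⨅ a, hyperplaneOf (v a) = (Submodule.span ℝ (Set.range v))ᗮ := by
      rw [Submodule.span_range_eq_iSup, Submodule.iInf_orthogonal]
    have hdim := Submodule.finrank_add_finrank_orthogonal (Submodule.span ℝ (Set.range v))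
    rw [finrank_span_eq_card hv, finrank_euclideanSpace_fin, Fintype.card_fin] at hdim
    rw [hperp]
    omega
  · simpa [Submodule.mem_orthogonal_singleton_iff_inner_right] using hx

end Reflections

section Slices

open MvPolynomial

variable {σ : Type*} [Fintype σ] {n : ℕ}

/-- The affine subspace through `x` in the directions `e i`, parametrized by the coordinates along
these directions. -/
noncomputable def slice (e : σ → EucSpace n) (x : EucSpace n) :
    EuclideanSpace ℝ σ →ᵃ[ℝ] EucSpace n :=
  AffineMap.const ℝ _ (x - ∑ i, ⟪e i, x⟫ • e i) +
    (Fintype.linearCombination ℝ e ∘ₗ (WithLp.linearEquiv 2 ℝ (σ → ℝ)).toLinearMap).toAffineMap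

theorem slice_apply (e : σ → EucSpace n) (x : EucSpace n) (y : σ → ℝ) :
    slice e x (WithLp.toLp 2 y) =
      x - ∑ i, ⟪e i, x⟫ • e i + Fintype.linearCombination ℝ e y :=
  rfl

theorem slice_inner (e : σ → EucSpace n) (x : EucSpace n) :
    slice e x (WithLp.toLp 2 fun i => ⟪e i, x⟫) = x := by
  rw [slice_apply, Fintype.linearCombination_apply, sub_add_cancel]

theorem slice_sub_smul (e : σ → EucSpace n) (x : EucSpace n) (y r : σ → ℝ) (c : ℝ) :
    slice e x (WithLp.toLp 2 (y - c • r)) =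
      slice e x (WithLp.toLp 2 y) - c • Fintype.linearCombination ℝ e r := by
  rw [slice_apply, slice_apply, map_sub, map_smul, add_sub_assoc]

theorem inner_linearCombination_slice {e : σ → EucSpace n} (he : Orthonormal ℝ e) (x : EucSpace n)
    (r y : σ → ℝ) :
    ⟪Fintype.linearCombination ℝ e r, slice e x (WithLp.toLp 2 y)⟫ = r ⬝ᵥ y := by
  have hcoord (i : σ) : ⟪e i, slice e x (WithLp.toLp 2 y)⟫ = y i := by
    classical
    rw [slice_apply, inner_add_right, inner_sub_right, he.inner_right_fintype,
      Fintype.linearCombination_apply, he.inner_right_fintype, sub_self, zero_add]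
  simp [Fintype.linearCombination_apply, sum_inner, inner_smul_left, hcoord, dotProduct]

/-- An orthonormal family `e` in which the vectors `e i ± e j` are roots of `G`; thus `G` contains
a reflection group of type `D`. -/
structure IsFrameD [DecidableEq σ] (G : Subgroup (OrthGroup n)) (e : σ → EucSpace n) :
    Prop where
  orthonormal : Orthonormal ℝ e
  reflectionAlong_mem : ∀ r, IsRootD r → reflectionAlong (Fintype.linearCombination ℝ e r) ∈ G

namespace IsFrameD

variable [DecidableEq σ] {G : Subgroup (OrthGroup n)} {e : σ → EucSpace n}

theorem reflectionAlong_slice (he : IsFrameD G e) (x : EucSpace n) {r : σ → ℝ} (hr : IsRootD r)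
    (y : σ → ℝ) :
    reflectionAlong (Fintype.linearCombination ℝ e r) (slice e x (WithLp.toLp 2 y)) =
      slice e x (WithLp.toLp 2 (y - (r ⬝ᵥ y) • r)) := by
  have hself : ⟪Fintype.linearCombination ℝ e r, Fintype.linearCombination ℝ e r⟫ = 2 := by
    simpa [slice_apply, hr.dotProduct_self] using inner_linearCombination_slice he.orthonormal 0 r r
  rw [reflectionAlong_apply, inner_linearCombination_slice he.orthonormal, hself, slice_sub_smul,
    mul_div_cancel_left₀ _ two_ne_zero]

theorem isInvariantD_affinePullback_slice (he : IsFrameD G e) (x : EucSpace n)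
    {f : MvPolynomial (Fin n) ℝ} (hf : f ∈ invariantRing G) :
    IsInvariantD (affinePullback (slice e x) f) := by
  refine isInvariantD_of_reflection fun r hr y => ?_
  have hrefl := hf _ (he.reflectionAlong_mem r hr) (slice e x (WithLp.toLp 2 y))
  rw [he.reflectionAlong_slice x hr] at hrefl
  exact (eval_affinePullback _ f (WithLp.toLp 2 _)).trans
    (hrefl.trans (eval_affinePullback _ f (WithLp.toLp 2 y)).symm)

theorem slice_mem_stratum (he : IsFrameD G e) (x : EucSpace n) {y : σ → ℝ}
    (hy : OrthogonalToTwoRootsD y) : slice e x (WithLp.toLp 2 y) ∈ stratum G (n - 2) := by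
  obtain ⟨r, hr, hroot⟩ := hy
  have hker : LinearMap.ker (Fintype.linearCombination ℝ e) = ⊥ :=
    LinearMap.ker_eq_bot.mpr he.orthonormal.linearIndependent.fintypeLinearCombination_injective
  refine mem_stratum_of_linearIndependent (hr.map' _ hker)
    (fun a => he.reflectionAlong_mem _ (hroot a).1) fun a => ?_
  exact (inner_linearCombination_slice he.orthonormal x (r a) y).trans (hroot a).2

theorem exists_mem_stratum_evalAt_eq (he : IsFrameD G e) {k : ℕ} (hk : 1 ≤ k)
    (hσ : Fintype.card σ = k + 3) (x : EucSpace n) :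
    ∃ z ∈ stratum G (n - 2), ∀ f ∈ invariantRing G, f.totalDegree ≤ 2 * k + 1 →
      evalAt z f = evalAt x f := by
  have : Nonempty σ := Fintype.card_pos_iff.mp (by omega)
  obtain ⟨y, hy, hroots⟩ := exists_orthogonalToTwoRootsD hk hσ fun i => ⟪e i, x⟫
  refine ⟨slice e x (WithLp.toLp 2 y), he.slice_mem_stratum x hroots, fun f hf hdeg => ?_⟩
  have heval := (he.isInvariantD_affinePullback_slice x hf).eval_eq
    ((totalDegree_affinePullback_le _ f).trans hdeg) hy
  have hslice (w : σ → ℝ) : eval w (affinePullback (slice e x) f) =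
      evalAt (slice e x (WithLp.toLp 2 w)) f := eval_affinePullback _ f (WithLp.toLp 2 w)
  rw [hslice, hslice, slice_inner] at heval
  exact heval

theorem inter_stratum_nonempty (he : IsFrameD G e) {k : ℕ} (hk : 1 ≤ k)
    (hσ : Fintype.card σ = k + 3) {j : ℕ}
    (hdeg : ∀ π, IsBasicInvariants G π → ∀ i : Fin n, (i : ℕ) < j →
      (π i).totalDegree ≤ 2 * k + 1)
    {X : Set (EucSpace n)} (hX : IsSparse G j X) (hne : X.Nonempty) :
    (X ∩ stratum G (n - 2)).Nonempty := by
  obtain ⟨π, hπ, m, f, hf, rfl⟩ := hX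
  obtain ⟨x, hx⟩ := hne
  obtain ⟨z, hz, hzx⟩ := he.exists_mem_stratum_evalAt_eq hk hσ x
  refine ⟨z, fun l => ?_, hz⟩
  have hle : Algebra.adjoin ℝ (π '' {i : Fin n | (i : ℕ) < j}) ≤
      AlgHom.equalizer (aeval z.ofLp) (aeval x.ofLp) := by
    refine Algebra.adjoin_le ?_
    rintro _ ⟨i, hi, rfl⟩
    exact hzx _ (hπ.adjoin_eq ▸ Algebra.subset_adjoin ⟨i, rfl⟩) (hdeg π hπ i hi)
  exact Eq.trans (hle (hf l)) (hx l)

end IsFrameD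

end Slices

section LowDegree

open MvPolynomial

variable {σ ι : Type*}

/-- The restriction of a polynomial to the line through the origin and `x`. -/
noncomputable def restrictLine (x : σ → ℝ) : MvPolynomial σ ℝ →ₐ[ℝ] Polynomial ℝ :=
  aeval fun i => Polynomial.C (x i) * Polynomial.X

theorem eval_restrictLine (x : σ → ℝ) (f : MvPolynomial σ ℝ) (r : ℝ) :
    (restrictLine x f).eval r = eval (r • x) f := by
  have h : (Polynomial.aeval r).comp (restrictLine x) = aeval (r • x) := by
    ext i
    simp [restrictLine, mul_comm (x i) r]
  exact DFunLike.congr_fun h f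

theorem natDegree_restrictLine_le (x : σ → ℝ) (f : MvPolynomial σ ℝ) :
    (restrictLine x f).natDegree ≤ f.totalDegree := by
  simpa [restrictLine] using aeval_natDegree_le f le_rfl (n := 1)
    (fun i => Polynomial.C (x i) * Polynomial.X)
    fun i => (Polynomial.natDegree_C_mul_le _ _).trans Polynomial.natDegree_X_le

theorem eval_smul_of_isHomogeneous {f : MvPolynomial σ ℝ} {d : ℕ} (hf : f.IsHomogeneous d)
    (x : σ → ℝ) (r : ℝ) : eval (r • x) f = r ^ d * eval x f := by
  rw [eval_eq, eval_eq, Finset.mul_sum]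
  refine Finset.sum_congr rfl fun s hs => ?_
  simp only [Pi.smul_apply, smul_eq_mul, mul_pow, Finset.prod_mul_distrib,
    Finset.prod_pow_eq_pow_sum]
  rw [hf.degree_eq_sum_deg_support hs, mul_left_comm]

theorem restrictLine_of_isHomogeneous {f : MvPolynomial σ ℝ} {d : ℕ} (hf : f.IsHomogeneous d)
    (x : σ → ℝ) : restrictLine x f = Polynomial.C (eval x f) * Polynomial.X ^ d := by
  refine Polynomial.funext fun r => ?_
  rw [eval_restrictLine, eval_smul_of_isHomogeneous hf, Polynomial.eval_mul, Polynomial.eval_C,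
    Polynomial.eval_pow, Polynomial.eval_X, mul_comm]

theorem eval_eq_of_mem_adjoin {D : ℕ} {π : ι → MvPolynomial σ ℝ} (i₀ : ι)
    (hom : ∀ i, (π i).IsHomogeneous (π i).totalDegree)
    (hbig : ∀ i, i ≠ i₀ → D < (π i).totalDegree) {f : MvPolynomial σ ℝ}
    (hf : f ∈ Algebra.adjoin ℝ (Set.range π)) (hfD : f.totalDegree ≤ D) {x x' : σ → ℝ}
    (h : eval x (π i₀) = eval x' (π i₀)) : eval x f = eval x' f := by
  let truncate := Ideal.Quotient.mkₐ ℝ (Ideal.span {(Polynomial.X : Polynomial ℝ) ^ (D + 1)})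
  have htruncate {a b : Polynomial ℝ} :
      truncate a = truncate b ↔ Polynomial.X ^ (D + 1) ∣ a - b := by
    rw [← Ideal.mem_span_singleton]
    exact Ideal.Quotient.mk_eq_mk_iff_sub_mem a b
  have hle : Algebra.adjoin ℝ (Set.range π) ≤
      AlgHom.equalizer (truncate.comp (restrictLine x)) (truncate.comp (restrictLine x')) := by
    refine Algebra.adjoin_le ?_
    rintro _ ⟨i, rfl⟩
    refine htruncate.mpr ?_
    change _ ∣ restrictLine x (π i) - restrictLine x' (π i)
    rw [restrictLine_of_isHomogeneous (hom i), restrictLine_of_isHomogeneous (hom i)]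
    rcases eq_or_ne i i₀ with rfl | hi
    · simp [h]
    · rw [← sub_mul]
      exact (pow_dvd_pow _ (hbig i hi)).mul_left _
  have hdeg : (restrictLine x f - restrictLine x' f).natDegree < D + 1 :=
    Nat.lt_succ_of_le ((Polynomial.natDegree_sub_le_of_le (natDegree_restrictLine_le x f)
      (natDegree_restrictLine_le x' f)).trans ((max_self _).trans_le hfD))
  have heq : restrictLine x f = restrictLine x' f :=
    sub_eq_zero.mp (Polynomial.eq_zero_of_dvd_of_natDegree_lt (htruncate.mp (hle hf))
      (by rwa [Polynomial.natDegree_X_pow]))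
  simpa [eval_restrictLine] using congrArg (Polynomial.eval 1) heq

end LowDegree

section SecondDegree

variable {n : ℕ} {f : MvPolynomial (Fin n) ℝ} {d : ℕ}

theorem continuous_evalAt (f : MvPolynomial (Fin n) ℝ) :
    Continuous fun p : EucSpace n => evalAt p f :=
  (MvPolynomial.continuous_eval f).comp (PiLp.continuous_ofLp 2 _)

theorem evalAt_smul (hf : f.IsHomogeneous d) (p : EucSpace n) (r : ℝ) :
    evalAt (r • p) f = r ^ d * evalAt p f :=
  eval_smul_of_isHomogeneous hf p.ofLp r

theorem evalAt_ne_zero_of_norm_eq (hf : f.IsHomogeneous d)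
    (hnorm : ∀ p q : EucSpace n, evalAt p f = evalAt q f → ‖p‖ = ‖q‖) {p : EucSpace n}
    (hp : p ≠ 0) : evalAt p f ≠ 0 := by
  intro h0
  have hscale := hnorm ((2 : ℝ) • p) p (by rw [evalAt_smul hf, h0, mul_zero])
  rw [norm_smul, Real.norm_two] at hscale
  exact hp (norm_eq_zero.mp (by linarith))

theorem div_pos_of_isPreconnected {E : Type*} [TopologicalSpace E] {s : Set E}
    (hs : IsPreconnected s) {φ : E → ℝ} (hφ : ContinuousOn φ s) (h0 : ∀ y ∈ s, φ y ≠ 0) {p q : E}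
    (hp : p ∈ s) (hq : q ∈ s) : 0 < φ p / φ q := by
  have hzero : (0 : ℝ) ∉ φ '' s := fun ⟨y, hy, hy0⟩ => h0 y hy hy0
  have himage := (hs.image φ hφ).ordConnected
  rcases (h0 p hp).lt_or_gt with hp0 | hp0 <;> rcases (h0 q hq).lt_or_gt with hq0 | hq0
  · exact div_pos_of_neg_of_neg hp0 hq0
  · exact absurd (himage.out ⟨p, hp, rfl⟩ ⟨q, hq, rfl⟩ ⟨hp0.le, hq0.le⟩) hzero
  · exact absurd (himage.out ⟨q, hq, rfl⟩ ⟨p, hp, rfl⟩ ⟨hq0.le, hp0.le⟩) hzero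
  · exact div_pos hp0 hq0

theorem evalAt_eq_of_norm_eq (hn : 2 ≤ n) (hf : f.IsHomogeneous d)
    (hnorm : ∀ p q : EucSpace n, evalAt p f = evalAt q f → ‖p‖ = ‖q‖) {p q : EucSpace n}
    (hpq : ‖p‖ = ‖q‖) : evalAt p f = evalAt q f := by
  rcases eq_or_ne p 0 with rfl | hp
  · rw [norm_zero, eq_comm, norm_eq_zero] at hpq
    rw [hpq]
  have hq : q ≠ 0 := norm_ne_zero_iff.mp (hpq ▸ norm_ne_zero_iff.mpr hp)
  rcases eq_or_ne d 0 with rfl | hd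
  · have hp0 := evalAt_smul hf p 0
    have hq0 := evalAt_smul hf q 0
    simp only [zero_smul, pow_zero, one_mul] at hp0 hq0
    exact hp0.symm.trans hq0
  have hconn : IsPreconnected ({0}ᶜ : Set (EucSpace n)) := by
    refine (isConnected_compl_singleton_of_one_lt_rank ?_ 0).isPreconnected
    rw [← Module.finrank_eq_rank, finrank_euclideanSpace_fin]
    exact_mod_cast hn
  have hpos : 0 < evalAt p f / evalAt q f :=
    div_pos_of_isPreconnected hconn (continuous_evalAt f).continuousOn
      (fun y hy => evalAt_ne_zero_of_norm_eq hf hnorm hy) hp hq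
  obtain ⟨r, hr, hrd⟩ : ∃ r : ℝ, 0 < r ∧ r ^ d = evalAt p f / evalAt q f :=
    ⟨_, Real.rpow_pos_of_pos hpos _, Real.rpow_inv_natCast_pow hpos.le hd⟩
  have hscale : evalAt (r • q) f = evalAt p f := by
    rw [evalAt_smul hf, hrd, div_mul_cancel₀ _ (evalAt_ne_zero_of_norm_eq hf hnorm hq)]
  have hr1 : r = 1 := by
    have hrq := hnorm _ _ hscale
    rw [norm_smul, Real.norm_of_nonneg hr.le, hpq] at hrq
    exact (mul_eq_right₀ (norm_ne_zero_iff.mpr hq)).mp hrq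
  rw [← hscale, hr1, one_smul]

/-- The squared norm as a polynomial. -/
noncomputable def normSqPoly (n : ℕ) : MvPolynomial (Fin n) ℝ := ∑ i, MvPolynomial.X i ^ 2

theorem evalAt_normSqPoly (p : EucSpace n) : evalAt p (normSqPoly n) = ‖p‖ ^ 2 := by
  simp [evalAt, normSqPoly, EuclideanSpace.norm_sq_eq]

theorem normSqPoly_mem_invariantRing (G : Subgroup (OrthGroup n)) :
    normSqPoly n ∈ invariantRing G := fun g _ p => by
  rw [evalAt_normSqPoly, evalAt_normSqPoly, LinearIsometryEquiv.norm_map]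

theorem totalDegree_normSqPoly_le : (normSqPoly n).totalDegree ≤ 2 :=
  (MvPolynomial.IsHomogeneous.sum _ _ _ fun i _ =>
    MvPolynomial.isHomogeneous_X_pow (R := ℝ) i 2).totalDegree_le

/-- Otherwise every invariant of degree at most `D`, in particular the squared norm, is a function
of the first basic invariant, which is then itself constant on spheres. -/
theorem IsBasicInvariants.totalDegree_le {G : Subgroup (OrthGroup n)}
    {π : Fin n → MvPolynomial (Fin n) ℝ} (hπ : IsBasicInvariants G π) (hn : 2 ≤ n) {D : ℕ}
    (hD : 2 ≤ D) (hf : f ∈ invariantRing G) (hfD : f.totalDegree ≤ D) {p q : EucSpace n}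
    (hpq : ‖p‖ = ‖q‖) (hne : evalAt p f ≠ evalAt q f) {i : Fin n} (hi : (i : ℕ) < 2) :
    (π i).totalDegree ≤ D := by
  by_contra! hcon
  let i₀ : Fin n := ⟨0, by omega⟩
  have hbig (j : Fin n) (hj : j ≠ i₀) : D < (π j).totalDegree := by
    have hj0 : (j : ℕ) ≠ 0 := fun h => hj (Fin.ext h)
    exact hcon.trans_le (hπ.monotone_degree (Fin.le_def.mpr (by omega)))
  have hfun {g : MvPolynomial (Fin n) ℝ} (hg : g ∈ invariantRing G) (hgD : g.totalDegree ≤ D)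
      {u v : EucSpace n} (huv : evalAt u (π i₀) = evalAt v (π i₀)) : evalAt u g = evalAt v g :=
    eval_eq_of_mem_adjoin i₀ hπ.homogeneous hbig (hπ.adjoin_eq ▸ hg) hgD huv
  refine hne (hfun hf hfD (evalAt_eq_of_norm_eq hn (hπ.homogeneous i₀) (fun u v huv => ?_) hpq))
  have hsq := hfun (normSqPoly_mem_invariantRing G) (totalDegree_normSqPoly_le.trans hD) huv
  rwa [evalAt_normSqPoly, evalAt_normSqPoly, sq_eq_sq₀ (norm_nonneg _) (norm_nonneg _)] at hsq

end SecondDegree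

section RootLattice

variable {ι : Type*} {n : ℕ}

/-- A basis of vectors of squared length `2` with integral inner products, such as the simple roots
of a simply laced root system. -/
structure IsRootBasis (b : Module.Basis ι ℝ (EucSpace n)) : Prop where
  inner_self : ∀ i, ⟪b i, b i⟫ = 2
  exists_inner_eq_intCast : ∀ i j, ∃ z : ℤ, ⟪b i, b j⟫ = z

namespace IsRootBasis

open Submodule

variable {b : Module.Basis ι ℝ (EucSpace n)}

theorem exists_inner_eq_intCast_of_mem_span (hb : IsRootBasis b) {v : EucSpace n}
    (hv : v ∈ span ℤ (Set.range b)) (i : ι) : ∃ z : ℤ, ⟪b i, v⟫ = z := by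
  induction hv using span_induction with
  | mem v hv =>
    obtain ⟨j, rfl⟩ := hv
    exact hb.exists_inner_eq_intCast i j
  | zero => exact ⟨0, by simp⟩
  | add v w _ _ hv hw =>
    obtain ⟨y, hy⟩ := hv
    obtain ⟨z, hz⟩ := hw
    exact ⟨y + z, by rw [inner_add_right, hy, hz, Int.cast_add]⟩
  | smul c v _ hv =>
    obtain ⟨z, hz⟩ := hv
    exact ⟨c * z, by rw [← Int.cast_smul_eq_zsmul ℝ, inner_smul_right, hz, Int.cast_mul]⟩

theorem reflectionAlong_sub_mem (hb : IsRootBasis b) {p : EucSpace n} {i : ι}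
    (hp : ∃ z : ℤ, ⟪b i, p⟫ = z) : reflectionAlong (b i) p - p ∈ span ℤ (Set.range b) := by
  obtain ⟨z, hz⟩ := hp
  rw [reflectionAlong_apply, hb.inner_self, hz, mul_div_cancel_left₀ _ two_ne_zero,
    sub_sub_cancel_left, Int.cast_smul_eq_zsmul]
  exact neg_mem (zsmul_mem (subset_span (Set.mem_range_self i)) z)

theorem apply_sub_mem (hb : IsRootBasis b) {p : EucSpace n} (hp : ∀ i, ∃ z : ℤ, ⟪b i, p⟫ = z)
    {g : OrthGroup n} (hg : g ∈ Subgroup.closure (Set.range fun i => reflectionAlong (b i))) :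
    g p - p ∈ span ℤ (Set.range b) := by
  have hstep (i : ι) (g : OrthGroup n) (hg : g p - p ∈ span ℤ (Set.range b)) :
      (reflectionAlong (b i) * g) p - p ∈ span ℤ (Set.range b) := by
    have hgp : ∃ z : ℤ, ⟪b i, g p⟫ = z := by
      obtain ⟨y, hy⟩ := hp i
      obtain ⟨z, hz⟩ := hb.exists_inner_eq_intCast_of_mem_span hg i
      exact ⟨y + z, by rw [Int.cast_add, ← hy, ← hz, ← inner_add_right, add_sub_cancel]⟩
    simpa using add_mem (hb.reflectionAlong_sub_mem hgp) hg
  induction hg using Subgroup.closure_induction_left with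
  | one => simp
  | mul_left _ hx g _ ih =>
    obtain ⟨i, rfl⟩ := hx
    exact hstep i g ih
  | inv_mul_cancel _ hx g _ ih =>
    obtain ⟨i, rfl⟩ := hx
    rw [show (reflectionAlong (b i))⁻¹ = reflectionAlong (b i) from reflection_symm]
    exact hstep i g ih

theorem apply_basis_mem (hb : IsRootBasis b) {g : OrthGroup n}
    (hg : g ∈ Subgroup.closure (Set.range fun i => reflectionAlong (b i))) (i : ι) :
    g (b i) ∈ Metric.closedBall 0 √2 ∩ (span ℤ (Set.range b) : Set (EucSpace n)) := by
  refine ⟨?_, ?_⟩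
  · rw [mem_closedBall_zero_iff, LinearIsometryEquiv.norm_map, norm_eq_sqrt_real_inner,
      hb.inner_self]
  · have hsub := hb.apply_sub_mem (fun j => hb.exists_inner_eq_intCast j i) hg
    exact (sub_mem_iff_left _ (subset_span (Set.mem_range_self i))).mp hsub

theorem finite_closure [Finite ι] (hb : IsRootBasis b) :
    Finite (Subgroup.closure (Set.range fun i => reflectionAlong (b i))) := by
  have := (ZSpan.setFinite_inter b (Metric.isBounded_closedBall (x := 0) (r := √2))).to_subtype
  refine Finite.of_injective (fun g i => Subtype.mk (g.1 (b i)) (hb.apply_basis_mem g.2 i))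
    fun g g' h => Subtype.ext (LinearIsometryEquiv.toLinearEquiv_injective (b.ext' fun i => ?_))
  exact congrArg Subtype.val (congrFun h i)

end IsRootBasis

end RootLattice

section Averaging

variable {n : ℕ} (G : Subgroup (OrthGroup n)) [Fintype G]

/-- The sum of the translates of `f` under the finite group `G`. -/
noncomputable def orbitSum (f : MvPolynomial (Fin n) ℝ) : MvPolynomial (Fin n) ℝ :=
  ∑ g : G, affinePullback g.1.toLinearIsometry.toLinearMap.toAffineMap f

theorem evalAt_orbitSum (f : MvPolynomial (Fin n) ℝ) (p : EucSpace n) :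
    evalAt p (orbitSum G f) = ∑ g : G, evalAt (g.1 p) f := by
  rw [orbitSum, evalAt, map_sum]
  exact Finset.sum_congr rfl fun g _ => eval_affinePullback _ f p

theorem orbitSum_mem_invariantRing (f : MvPolynomial (Fin n) ℝ) :
    orbitSum G f ∈ invariantRing G := fun g hg p => by
  rw [evalAt_orbitSum, evalAt_orbitSum]
  exact Equiv.sum_comp (Equiv.mulRight (⟨g, hg⟩ : G)) fun g : G => evalAt (g.1 p) f

theorem totalDegree_orbitSum_le (f : MvPolynomial (Fin n) ℝ) :
    (orbitSum G f).totalDegree ≤ f.totalDegree :=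
  MvPolynomial.totalDegree_finsetSum_le fun _ _ => totalDegree_affinePullback_le _ f

end Averaging

theorem IsBasicInvariants.totalDegree_le_of_orbits {n : ℕ} {G : Subgroup (OrthGroup n)} [Finite G]
    {π : Fin n → MvPolynomial (Fin n) ℝ} (hπ : IsBasicInvariants G π) (hn : 2 ≤ n) {D : ℕ}
    (hD : 2 ≤ D) {f : MvPolynomial (Fin n) ℝ} (hfD : f.totalDegree ≤ D) {p q : EucSpace n}
    (hpq : ‖p‖ = ‖q‖) (hp : ∀ g ∈ G, evalAt (g p) f ≤ 0) (hq : ∀ g ∈ G, 0 ≤ evalAt (g q) f)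
    (hlt : evalAt p f < evalAt q f) {i : Fin n} (hi : (i : ℕ) < 2) : (π i).totalDegree ≤ D := by
  cases nonempty_fintype G
  refine hπ.totalDegree_le hn hD (orbitSum_mem_invariantRing G f)
    ((totalDegree_orbitSum_le G f).trans hfD) hpq (ne_of_lt ?_) hi
  rw [evalAt_orbitSum, evalAt_orbitSum]
  exact Finset.sum_lt_sum (fun g _ => (hp g g.2).trans (hq g g.2)) ⟨1, Finset.mem_univ _, hlt⟩

section Coordinates

variable {n k : ℕ}

theorem exists_linearIsometryEquiv_of_inner_eq {ι E F : Type*} [NormedAddCommGroup E]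
    [InnerProductSpace ℝ E] [FiniteDimensional ℝ E] [NormedAddCommGroup F] [InnerProductSpace ℝ F]
    [FiniteDimensional ℝ F] (b : Module.Basis ι ℝ E) (v : ι → F)
    (hdim : Module.finrank ℝ E = Module.finrank ℝ F) (h : ∀ i j, ⟪b i, b j⟫ = ⟪v i, v j⟫) :
    ∃ φ : E ≃ₗᵢ[ℝ] F, ∀ i, φ (b i) = v i := by
  let ψ := b.constr ℝ v
  have hψ : (innerₗ F).compl₁₂ ψ ψ = innerₗ E :=
    b.ext fun i => b.ext fun j => by simp [ψ, h]
  let φ := ψ.isometryOfInner fun x y => LinearMap.congr_fun₂ hψ x y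
  exact ⟨φ.toLinearIsometryEquiv hdim, fun i => b.constr_basis ℝ v i⟩

theorem reflectionAlong_sub_apply_of_orthonormal {σ : Type*} [DecidableEq σ] {e : σ → EucSpace n}
    (he : Orthonormal ℝ e) {i j : σ} (hij : i ≠ j) (l : σ) :
    reflectionAlong (e i - e j) (e l) = e (Equiv.swap i j l) := by
  have hself : ⟪e i - e j, e i - e j⟫ = 2 := by
    rw [inner_sub_left, inner_sub_right, inner_sub_right]
    norm_num [he.1, he.2 hij, he.2 hij.symm]
  rw [reflectionAlong_apply, hself, mul_div_cancel_left₀ _ two_ne_zero, inner_sub_left]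
  simp only [orthonormal_iff_ite.mp he]
  rcases eq_or_ne l i with rfl | hi
  · simp [hij.symm]
  · rcases eq_or_ne l j with rfl | hj
    · simp [hij]
    · simp [hi.symm, hj.symm, Equiv.swap_apply_of_ne_of_ne hi hj]

theorem exists_perm_apply_zero_one {m : ℕ} {i j : Fin (m + 2)} (hij : i ≠ j) :
    ∃ τ : Equiv.Perm (Fin (m + 2)), τ 0 = i ∧ τ 1 = j := by
  refine ⟨Equiv.swap (Equiv.swap 0 i 1) j * Equiv.swap 0 i, ?_, ?_⟩
  · refine Equiv.swap_apply_of_ne_of_ne (fun h => ?_) ?_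
    · exact zero_ne_one ((Equiv.swap 0 i).injective h)
    · simpa using hij
  · simp

theorem exists_apply_eq_perm {m : ℕ} {G : Subgroup (OrthGroup n)} {e : Fin (m + 1) → EucSpace n}
    (he : Orthonormal ℝ e)
    (hG : ∀ i : Fin m, reflectionAlong (e i.succ - e i.castSucc) ∈ G)
    (τ : Equiv.Perm (Fin (m + 1))) : ∃ g ∈ G, ∀ l, g (e l) = e (τ l) := by
  have hτ : τ ∈ Submonoid.closure
      (Set.range fun i : Fin m => Equiv.swap i.castSucc i.succ) := by
    rw [Equiv.Perm.mclosure_swap_castSucc_succ]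
    trivial
  induction hτ using Submonoid.closure_induction with
  | mem _ h =>
    obtain ⟨i, rfl⟩ := h
    refine ⟨_, hG i, fun l => ?_⟩
    rw [reflectionAlong_sub_apply_of_orthonormal he Fin.castSucc_lt_succ.ne', Equiv.swap_comm]
  | one => exact ⟨1, G.one_mem, fun l => rfl⟩
  | mul τ τ' _ _ h h' =>
    obtain ⟨g, hg, hgτ⟩ := h
    obtain ⟨g', hg', hgτ'⟩ := h'
    exact ⟨g * g', G.mul_mem hg hg', fun l => by
      rw [LinearIsometryEquiv.coe_mul, Function.comp_apply, hgτ', hgτ, Equiv.Perm.mul_apply]⟩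

theorem isFrameD_of_simple {m : ℕ} {G : Subgroup (OrthGroup n)} {e : Fin (m + 2) → EucSpace n}
    (he : Orthonormal ℝ e) (hadd : reflectionAlong (e 0 + e 1) ∈ G)
    (hsub : ∀ i : Fin (m + 1), reflectionAlong (e i.succ - e i.castSucc) ∈ G) : IsFrameD G e := by
  refine ⟨he, ?_⟩
  rintro _ ⟨i, j, hij, rfl | rfl⟩
  · obtain ⟨τ, rfl, rfl⟩ := exists_perm_apply_zero_one hij.symm
    obtain ⟨g, hg, hgτ⟩ := exists_apply_eq_perm he hsub τ
    simpa [Fintype.linearCombination_apply_single, hgτ] using reflectionAlong_map_mem hg (hsub 0)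
  · obtain ⟨τ, rfl, rfl⟩ := exists_perm_apply_zero_one hij
    obtain ⟨g, hg, hgτ⟩ := exists_apply_eq_perm he hsub τ
    simpa [Fintype.linearCombination_apply_single, hgτ] using reflectionAlong_map_mem hg hadd

end Coordinates

section TypeE

variable {k : ℕ}

/-- Twice the coordinates, other than `none`, of the simple roots of `E_{k+4}`; see `simpleRootE`.
-/
def doubledRootE (k : ℕ) (l : Fin (k + 4)) (i : Fin (k + 3)) : ℤ :=
  if (l : ℕ) = 0 then if (i : ℕ) = 0 then 1 else -1
  else if (l : ℕ) = 1 then if (i : ℕ) ≤ 1 then 2 else 0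
  else if (l : ℕ) = i + 1 then 2 else if (l : ℕ) = i + 2 then -2 else 0

/-- The simple roots of `E_{k+4}` for `k = 2, 3, 4`, in the order of Bourbaki. His coordinates
`x_{k+4}, …, x_8`, which agree on these roots up to sign, are merged into the coordinate `none`,
with respect to a unit vector in the direction `-e_{k+4} - ⋯ - e_7 + e_8`. -/
noncomputable def simpleRootE (k : ℕ) (l : Fin (k + 4)) : EuclideanSpace ℝ (Option (Fin (k + 3))) :=
  WithLp.toLp 2 fun o => o.elim (if l = 0 then √(5 - k) / 2 else 0) fun i => doubledRootE k l i / 2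

theorem inner_option {σ : Type*} [Fintype σ] (v w : EuclideanSpace ℝ (Option σ)) :
    ⟪v, w⟫ = v none * w none + ∑ i, v (some i) * w (some i) := by
  simp only [PiLp.inner_apply, Fintype.sum_option, Real.inner_apply]

theorem inner_simpleRootE (hk : k ≤ 5) (l l' : Fin (k + 4)) :
    ⟪simpleRootE k l, simpleRootE k l'⟫ =
      (((if l = 0 ∧ l' = 0 then (5 - k : ℤ) else 0) +
        ∑ i, doubledRootE k l i * doubledRootE k l' i : ℤ) : ℝ) / 4 := by
  have hκ : √(5 - k : ℝ) * √(5 - k) = 5 - k :=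
    Real.mul_self_sqrt (sub_nonneg.mpr (by exact_mod_cast hk))
  have hnone : simpleRootE k l none * simpleRootE k l' none =
      (if l = 0 ∧ l' = 0 then (5 - k : ℝ) else 0) / 4 := by
    by_cases hl : l = 0 <;> by_cases hl' : l' = 0 <;>
      simp [simpleRootE, hl, hl', div_mul_div_comm, hκ]
    norm_num
  have hsome (i : Fin (k + 3)) : simpleRootE k l (some i) * simpleRootE k l' (some i) =
      doubledRootE k l i * doubledRootE k l' i / 4 := by
    simp only [simpleRootE, Option.elim]
    ring
  rw [inner_option, hnone, Finset.sum_congr rfl fun i _ => hsome i, ← Finset.sum_div, ← add_div]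
  push_cast
  rfl

/-- The entry of the Cartan matrix corresponding to an entry of a simply laced Coxeter matrix. -/
def cartanEntry : ℕ → ℤ
  | 1 => 2
  | 3 => -1
  | _ => 0

theorem two_mul_neg_cos_eq_cartanEntry {N : ℕ} (h : N = 1 ∨ N = 2 ∨ N = 3) :
    2 * -Real.cos (Real.pi / N) = cartanEntry N := by
  rcases h with rfl | rfl | rfl <;> simp [cartanEntry]

/-- `u` is an orthonormal basis in which the scaled simple roots `b` of the reflection group `G` are
those of `simpleRootE`. -/
structure IsFrameE (G : Subgroup (OrthGroup (k + 4)))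
    (b : Module.Basis (Fin (k + 4)) ℝ (EucSpace (k + 4)))
    (u : OrthonormalBasis (Option (Fin (k + 3))) ℝ (EucSpace (k + 4))) : Prop where
  isRootBasis : IsRootBasis b
  eq_closure : G = Subgroup.closure (Set.range fun l => reflectionAlong (b l))
  repr_eq : ∀ l, u.repr (b l) = simpleRootE k l

theorem exists_isFrameE_of_gram (hk : k ≤ 5) {M : CoxeterMatrix (Fin (k + 4))}
    {G : Subgroup (OrthGroup (k + 4))} (hG : IsOfCoxeterType M G)
    (hM : ∀ l l', M l l' = 1 ∨ M l l' = 2 ∨ M l l' = 3)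
    (hgram : ∀ l l', (if l = 0 ∧ l' = 0 then (5 - k : ℤ) else 0) +
      ∑ i, doubledRootE k l i * doubledRootE k l' i = 4 * cartanEntry (M l l')) :
    ∃ b u, IsFrameE G b u := by
  obtain ⟨α, hα, hinner, rfl⟩ := hG
  have h2 : √(2 : ℝ) ≠ 0 := by positivity
  have hcard : Fintype.card (Fin (k + 4)) = Module.finrank ℝ (EucSpace (k + 4)) := by simp
  let b := (basisOfLinearIndependentOfCardEqFinrank hα hcard).isUnitSMul fun _ => h2.isUnit
  have hb (l : Fin (k + 4)) : b l = √2 • α l := by simp [b, Module.Basis.isUnitSMul_apply]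
  have hcartan (l l' : Fin (k + 4)) : ⟪b l, b l'⟫ = cartanEntry (M l l') := by
    rw [hb, hb, inner_smul_left, inner_smul_right, conj_trivial, ← mul_assoc,
      Real.mul_self_sqrt zero_le_two, hinner, two_mul_neg_cos_eq_cartanEntry (hM l l')]
  have hgram_eq (l l' : Fin (k + 4)) : ⟪b l, b l'⟫ = ⟪simpleRootE k l, simpleRootE k l'⟫ := by
    rw [hcartan, inner_simpleRootE hk, hgram]
    push_cast
    ring
  obtain ⟨φ, hφ⟩ := exists_linearIsometryEquiv_of_inner_eq b (simpleRootE k) (by simp) hgram_eq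
  refine ⟨b, OrthonormalBasis.ofRepr φ, ⟨fun l => ?_, fun l l' => ⟨_, hcartan l l'⟩⟩, ?_, hφ⟩
  · rw [hcartan, M.diagonal]
    norm_num [cartanEntry]
  · simp only [hb, reflectionAlong_smul h2]

set_option maxRecDepth 100000 in
theorem exists_isFrameE_two {G : Subgroup (OrthGroup 6)} (hG : IsTypeE G) :
    ∃ b u, IsFrameE (k := 2) G b u :=
  exists_isFrameE_of_gram (by norm_num) hG
    (by intro i j; fin_cases i <;> fin_cases j <;> simp [CoxeterMatrix.E₆]) (by decide)

set_option maxRecDepth 100000 in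
theorem exists_isFrameE_three {G : Subgroup (OrthGroup 7)} (hG : IsTypeE G) :
    ∃ b u, IsFrameE (k := 3) G b u :=
  exists_isFrameE_of_gram (by norm_num) hG
    (by intro i j; fin_cases i <;> fin_cases j <;> simp [CoxeterMatrix.E₇]) (by decide)

set_option maxRecDepth 100000 in
theorem exists_isFrameE_four {G : Subgroup (OrthGroup 8)} (hG : IsTypeE G) :
    ∃ b u, IsFrameE (k := 4) G b u :=
  exists_isFrameE_of_gram (by norm_num) hG
    (by intro i j; fin_cases i <;> fin_cases j <;> simp [CoxeterMatrix.E₈]) (by decide)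

end TypeE

section RootsE

variable {k : ℕ}

/-- The vectors whose coordinates are congruent to those of an integral multiple of the root
`simpleRootE k 0`; this lattice contains the root lattice of `E_{k+4}`. -/
def latticeE (k : ℕ) : AddSubgroup (EuclideanSpace ℝ (Option (Fin (k + 3)))) where
  carrier := {v | ∃ s : ℤ, v none = √(5 - k) * (s / 2) ∧ ∀ i, ∃ r : ℤ, v (some i) = s / 2 + r}
  add_mem' := by
    rintro v w ⟨s, hs, hr⟩ ⟨s', hs', hr'⟩
    refine ⟨s + s', ?_, fun i => ?_⟩
    · rw [PiLp.add_apply, hs, hs']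
      push_cast
      ring
    · obtain ⟨r, hr⟩ := hr i
      obtain ⟨r', hr'⟩ := hr' i
      refine ⟨r + r', ?_⟩
      rw [PiLp.add_apply, hr, hr']
      push_cast
      ring
  zero_mem' := ⟨0, by simp, fun i => ⟨0, by simp⟩⟩
  neg_mem' := by
    rintro v ⟨s, hs, hr⟩
    refine ⟨-s, ?_, fun i => ?_⟩
    · rw [PiLp.neg_apply, hs]
      push_cast
      ring
    · obtain ⟨r, hr⟩ := hr i
      refine ⟨-r, ?_⟩
      rw [PiLp.neg_apply, hr]
      push_cast
      ring

theorem exists_doubledRootE_eq (l : Fin (k + 4)) (i : Fin (k + 3)) :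
    ∃ r : ℤ, doubledRootE k l i = (if l = 0 then 1 else 0) + 2 * r := by
  have hl : (l : ℕ) = 0 ↔ l = 0 := Fin.val_eq_zero_iff
  simp only [doubledRootE, hl]
  split_ifs
  exacts [⟨0, rfl⟩, ⟨-1, rfl⟩, ⟨1, rfl⟩, ⟨0, rfl⟩, ⟨1, rfl⟩, ⟨-1, rfl⟩, ⟨0, rfl⟩]

theorem exists_simpleRootE_eq (l : Fin (k + 4)) :
    ∃ (s : ℤ) (r : Fin (k + 3) → ℤ), simpleRootE k l none = √(5 - k) * (s / 2) ∧
      ∀ i, simpleRootE k l (some i) = s / 2 + r i := by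
  choose r hr using exists_doubledRootE_eq l
  refine ⟨if l = 0 then 1 else 0, r, ?_, fun i => ?_⟩
  · by_cases hl : l = 0 <;> simp [simpleRootE, hl, div_eq_mul_inv]
  · simp only [simpleRootE, Option.elim, hr]
    push_cast
    ring

theorem exists_inner_simpleRootE_eq_intCast {x : EuclideanSpace ℝ (Option (Fin (k + 3)))}
    (hx : ∀ i, ∃ r : ℤ, x (some i) = r)
    (hsum : ∃ z : ℤ, √(5 - k) * x none + ∑ i, x (some i) = 2 * z) (l : Fin (k + 4)) :
    ∃ z : ℤ, ⟪simpleRootE k l, x⟫ = z := by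
  choose t ht using hx
  obtain ⟨z, hz⟩ := hsum
  obtain ⟨s, r, hs, hr⟩ := exists_simpleRootE_eq l
  refine ⟨s * z + ∑ i, r i * t i, ?_⟩
  have hsplit : ⟪simpleRootE k l, x⟫ =
      s / 2 * (√(5 - k) * x none + ∑ i, x (some i)) + ∑ i, r i * x (some i) := by
    simp only [inner_option, hs, hr, add_mul, Finset.sum_add_distrib, ← Finset.mul_sum]
    ring
  rw [hsplit, hz]
  simp only [ht]
  push_cast
  ring

namespace IsFrameE

variable {G : Subgroup (OrthGroup (k + 4))} {b : Module.Basis (Fin (k + 4)) ℝ (EucSpace (k + 4))}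
  {u : OrthonormalBasis (Option (Fin (k + 3))) ℝ (EucSpace (k + 4))}

theorem repr_mem_latticeE (h : IsFrameE G b u) {v : EucSpace (k + 4)}
    (hv : v ∈ Submodule.span ℤ (Set.range b)) : u.repr v ∈ latticeE k := by
  induction hv using Submodule.span_induction with
  | mem v hv =>
    obtain ⟨l, rfl⟩ := hv
    obtain ⟨s, r, hs, hr⟩ := exists_simpleRootE_eq l
    rw [h.repr_eq]
    exact ⟨s, hs, fun i => ⟨r i, hr i⟩⟩
  | zero => simp
  | add v w _ _ hv hw => simpa using add_mem hv hw
  | smul c v _ hv => simpa using zsmul_mem hv c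

theorem repr_apply_sub_mem (h : IsFrameE G b u) {p : EucSpace (k + 4)}
    (hp : ∀ i, ∃ r : ℤ, u.repr p (some i) = r)
    (hsum : ∃ z : ℤ, √(5 - k) * u.repr p none + ∑ i, u.repr p (some i) = 2 * z)
    {g : OrthGroup (k + 4)} (hg : g ∈ G) : u.repr (g p) - u.repr p ∈ latticeE k := by
  rw [← map_sub]
  refine h.repr_mem_latticeE (h.isRootBasis.apply_sub_mem (fun l => ?_) (h.eq_closure ▸ hg))
  rw [← u.repr.inner_map_map, h.repr_eq]
  exact exists_inner_simpleRootE_eq_intCast hp hsum l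

theorem finite (h : IsFrameE G b u) : Finite G :=
  h.eq_closure ▸ h.isRootBasis.finite_closure

theorem reflectionAlong_mem (h : IsFrameE G b u) (l : Fin (k + 4)) :
    reflectionAlong (b l) ∈ G := by
  rw [h.eq_closure]
  exact Subgroup.subset_closure ⟨l, rfl⟩

theorem add_eq (h : IsFrameE G b u) : u (some 0) + u (some 1) = b 1 := by
  refine u.repr.injective ?_
  rw [map_add, u.repr_self, u.repr_self, h.repr_eq]
  ext (_ | i)
  · simp [simpleRootE]
  · rcases i with ⟨_ | _ | i, hi⟩ <;> simp [simpleRootE, doubledRootE, Fin.ext_iff]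

theorem sub_eq (h : IsFrameE G b u) (i : Fin (k + 2)) :
    u (some i.succ) - u (some i.castSucc) = b i.succ.succ := by
  refine u.repr.injective ?_
  rw [map_sub, u.repr_self, u.repr_self, h.repr_eq]
  ext (_ | j)
  · simp [simpleRootE]
  · have hsucc : j = i.succ ↔ (i : ℕ) = j - 1 ∧ 0 < (j : ℕ) := by
      rw [Fin.ext_iff, Fin.val_succ]
      lia
    have hcast : j = i.castSucc ↔ (i : ℕ) = j := by
      rw [Fin.ext_iff, Fin.val_castSucc, eq_comm]
    simp only [simpleRootE, doubledRootE, PiLp.sub_apply, PiLp.single_apply,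
      Option.some.injEq, Option.elim, Fin.val_succ, hsucc, hcast]
    split_ifs <;> first | lia | norm_num

theorem isFrameD (h : IsFrameE G b u) : IsFrameD G fun i => u (some i) :=
  isFrameD_of_simple (u.orthonormal.comp some (Option.some_injective _))
    (h.add_eq ▸ h.reflectionAlong_mem 1) fun i => h.sub_eq i ▸ h.reflectionAlong_mem _

end IsFrameE

end RootsE

section TestPolynomials

open MvPolynomial

theorem one_le_intCast_sq {m : ℤ} (hm : m ≠ 0) : (1 : ℝ) ≤ m ^ 2 := by
  exact_mod_cast (one_le_sq_iff_one_le_abs m).mpr (Int.one_le_abs hm)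

theorem sq_eq_quarter_of_odd {ι : Type*} [Fintype ι] {s : ℤ} {w : ι → ℝ} (hs : Odd s)
    (hw : ∀ i, ∃ r : ℤ, w i = s / 2 + r) (hsum : ∑ i, w i ^ 2 ≤ Fintype.card ι / 4) (i : ι) :
    w i ^ 2 = 1 / 4 := by
  have hle (i : ι) : 1 / 4 ≤ w i ^ 2 := by
    obtain ⟨r, hr⟩ := hw i
    have hodd : s + 2 * r ≠ 0 := by grind
    have hsq : (1 : ℝ) ≤ (s + 2 * r) ^ 2 := by exact_mod_cast one_le_intCast_sq hodd
    rw [hr]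
    linarith
  refine ((Finset.sum_eq_sum_iff_of_le fun i _ => hle i).mp
    (le_antisymm (Finset.sum_le_sum fun i _ => hle i) ?_) i (Finset.mem_univ i)).symm
  simpa [div_eq_mul_inv] using hsum

theorem sq_eq_sq_of_half_integers {ι : Type*} [Fintype ι] {s : ℤ} {w : ι → ℝ}
    (hw : ∀ i, ∃ r : ℤ, w i = s / 2 + r) (hodd : Odd s → ∑ i, w i ^ 2 ≤ Fintype.card ι / 4)
    (heven : Even s → ∑ i, w i ^ 2 ≤ 0) (i j : ι) : w i ^ 2 = w j ^ 2 := by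
  rcases s.even_or_odd with hs | hs
  · have hzero := (Finset.sum_eq_zero_iff_of_nonneg fun i _ => sq_nonneg (w i)).mp
      ((heven hs).antisymm (Finset.sum_nonneg fun i _ => sq_nonneg (w i)))
    rw [hzero i (Finset.mem_univ i), hzero j (Finset.mem_univ j)]
  · rw [sq_eq_quarter_of_odd hs hw (hodd hs), sq_eq_quarter_of_odd hs hw (hodd hs)]

theorem mul_sq_sub_sq_nonpos_of_half_integers {s : ℤ} {c : ℝ} {w : Fin 5 → ℝ}
    (hc : c = √3 * (s / 2 - 1 / 3)) (hw : ∀ i, ∃ r : ℤ, w i = s / 2 + r)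
    (hnorm : c ^ 2 + ∑ i, w i ^ 2 = 4 / 3) : c * (w 0 ^ 2 - w 1 ^ 2) ^ 2 ≤ 0 := by
  rcases le_or_gt s 0 with hs | hs
  · refine mul_nonpos_of_nonpos_of_nonneg ?_ (sq_nonneg _)
    have hs' : (s : ℝ) ≤ 0 := by exact_mod_cast hs
    rw [hc]
    exact mul_nonpos_of_nonneg_of_nonpos (Real.sqrt_nonneg 3) (by linarith)
  have hc2 : c ^ 2 = (3 * s - 2) ^ 2 / 12 := by
    rw [hc, mul_pow, Real.sq_sqrt (by norm_num)]
    ring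
  have hbound {m : ℤ} (hm : 1 ≤ m) (hms : m ≤ s) :
      ∑ i, w i ^ 2 ≤ 4 / 3 - (3 * m - 2) ^ 2 / 12 := by
    have hm' : (1 : ℝ) ≤ m := by exact_mod_cast hm
    have hms' : (m : ℝ) ≤ s := by exact_mod_cast hms
    have : (3 * m - 2 : ℝ) ^ 2 ≤ (3 * s - 2) ^ 2 := by gcongr; linarith
    linarith
  rw [sq_eq_sq_of_half_integers hw (fun _ => (hbound le_rfl hs).trans (by norm_num))
    (fun he => (hbound one_le_two (by grind)).trans (by norm_num)) 0 1]
  simp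

theorem mul_sq_sub_sq_eq_zero_of_half_integers {s : ℤ} {c : ℝ} {w : Fin 6 → ℝ}
    (hc : c = √2 * (s / 2)) (hw : ∀ i, ∃ r : ℤ, w i = s / 2 + r)
    (hnorm : c ^ 2 + ∑ i, w i ^ 2 = 2) : c * (w 0 ^ 2 - w 1 ^ 2) = 0 := by
  rcases eq_or_ne s 0 with rfl | hs
  · simp [hc]
  have hc2 : c ^ 2 = s ^ 2 / 2 := by
    rw [hc, mul_pow, Real.sq_sqrt zero_le_two]
    ring
  have hbound {m : ℤ} (hm : 0 ≤ m) (hms : m ≤ |s|) : ∑ i, w i ^ 2 ≤ 2 - m ^ 2 / 2 := by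
    have : (m ^ 2 : ℝ) ≤ s ^ 2 := by exact_mod_cast sq_abs s ▸ pow_le_pow_left₀ hm hms 2
    linarith
  rw [sq_eq_sq_of_half_integers hw
    (fun _ => (hbound zero_le_one (Int.one_le_abs hs)).trans (by norm_num))
    (fun he => (hbound zero_le_two (by grind)).trans (by norm_num)) 0 1]
  simp

theorem mul_mul_sq_sub_sq_eq_zero_of_half_integers {s : ℤ} {c : ℝ} {w : Fin 7 → ℝ}
    (hc : c = s / 2) (hw : ∀ i, ∃ r : ℤ, w i = s / 2 + r)
    (hnorm : c ^ 2 + ∑ i, w i ^ 2 = 2) : c * w 2 * (w 0 ^ 2 - w 1 ^ 2) = 0 := by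
  have hc2 : c ^ 2 = s ^ 2 / 4 := by
    rw [hc]
    ring
  obtain ⟨t, rfl⟩ | hs := s.even_or_odd
  · have hsq {a : ℝ} (ha : a ≠ 0) (h_integer : ∃ m : ℤ, a = m) : 1 ≤ a ^ 2 := by
      obtain ⟨m, rfl⟩ := h_integer
      exact one_le_intCast_sq (by exact_mod_cast ha)
    by_contra! hne
    have hc1 := hsq (left_ne_zero_of_mul (left_ne_zero_of_mul hne))
      ⟨t, by rw [hc]; push_cast; ring⟩
    have hw1 := hsq (right_ne_zero_of_mul (left_ne_zero_of_mul hne)) (by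
      obtain ⟨r, hr⟩ := hw 2
      exact ⟨t + r, by rw [hr]; push_cast; ring⟩)
    simp only [Fin.sum_univ_seven] at hnorm
    refine right_ne_zero_of_mul hne (by nlinarith)
  · have hs1 : (1 : ℝ) ≤ s ^ 2 := one_le_intCast_sq (by grind)
    have hquarter := sq_eq_quarter_of_odd hs hw (by norm_num; linarith)
    rw [hquarter 0, hquarter 1, sub_self, mul_zero]

namespace IsFrameE

section

variable {k : ℕ} {G : Subgroup (OrthGroup (k + 4))}
  {b : Module.Basis (Fin (k + 4)) ℝ (EucSpace (k + 4))}
  {u : OrthonormalBasis (Option (Fin (k + 3))) ℝ (EucSpace (k + 4))}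
  {x y : EuclideanSpace ℝ (Option (Fin (k + 3)))}

theorem totalDegree_le (h : IsFrameE G b u) {π : Fin (k + 4) → MvPolynomial (Fin (k + 4)) ℝ}
    (hπ : IsBasicInvariants G π) {D : ℕ} (hD : 2 ≤ D)
    {f : MvPolynomial (Option (Fin (k + 3))) ℝ} (hfD : f.IsHomogeneous D) (hxy : ‖x‖ = ‖y‖)
    (hx : ∀ g ∈ G, eval (u.repr (g (u.repr.symm x))).ofLp f ≤ 0)
    (hy : ∀ g ∈ G, 0 ≤ eval (u.repr (g (u.repr.symm y))).ofLp f)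
    (hlt : eval x.ofLp f < eval y.ofLp f) {i : Fin (k + 4)} (hi : (i : ℕ) < 2) :
    (π i).totalDegree ≤ D := by
  have := h.finite
  let A := u.repr.toLinearIsometry.toLinearMap.toAffineMap
  have hA (p : EucSpace (k + 4)) : evalAt p (affinePullback A f) = eval (u.repr p).ofLp f :=
    eval_affinePullback A f p
  refine hπ.totalDegree_le_of_orbits (by lia) hD
    ((totalDegree_affinePullback_le A f).trans hfD.totalDegree_le) (p := u.repr.symm x)
    (q := u.repr.symm y) (by simpa using hxy) (fun g hg => ?_) (fun g hg => ?_) ?_ hi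
  · exact (hA _).trans_le (hx g hg)
  · exact (hy g hg).trans_eq (hA _).symm
  · simpa only [hA, LinearIsometryEquiv.apply_symm_apply] using hlt

theorem exists_repr_apply_eq (h : IsFrameE G b u) (hx : ∀ i, ∃ r : ℤ, x (some i) = r)
    (hsum : ∃ z : ℤ, √(5 - k) * x none + ∑ i, x (some i) = 2 * z)
    {g : OrthGroup (k + 4)} (hg : g ∈ G) {v : EuclideanSpace ℝ (Option (Fin (k + 3)))}
    (hv : u.repr (g (u.repr.symm x)) = v) :
    ∃ s : ℤ, v none = x none + √(5 - k) * (s / 2) ∧ (∀ i, ∃ r : ℤ, v (some i) = s / 2 + r) ∧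
      v none ^ 2 + ∑ i, v (some i) ^ 2 = x none ^ 2 + ∑ i, x (some i) ^ 2 := by
  obtain ⟨s, hs, hr⟩ := h.repr_apply_sub_mem (p := u.repr.symm x) (by simpa using hx)
    (by simpa using hsum) hg
  rw [hv, u.repr.apply_symm_apply] at hs hr
  refine ⟨s, eq_add_of_sub_eq' hs, fun i => ?_, ?_⟩
  · obtain ⟨t, ht⟩ := hx i
    obtain ⟨r, hr⟩ := hr i
    rw [PiLp.sub_apply, ht, sub_eq_iff_eq_add] at hr
    exact ⟨r + t, by rw [hr]; push_cast; ring⟩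
  · simpa only [inner_option, sq, hv, u.repr.apply_symm_apply] using
      (by simp : ⟪u.repr (g (u.repr.symm x)), u.repr (g (u.repr.symm x))⟫ =
        ⟪u.repr (u.repr.symm x), u.repr (u.repr.symm x)⟫)

end

/-- `x` is a minuscule weight. The test polynomial is odd, and nonpositive on the orbit of `x`. -/
theorem totalDegree_le_five {G : Subgroup (OrthGroup 6)} {b : Module.Basis (Fin 6) ℝ (EucSpace 6)}
    {u : OrthonormalBasis (Option (Fin 5)) ℝ (EucSpace 6)} (h : IsFrameE (k := 2) G b u)
    {π : Fin 6 → MvPolynomial (Fin 6) ℝ} (hπ : IsBasicInvariants G π) {i : Fin 6}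
    (hi : (i : ℕ) < 2) : (π i).totalDegree ≤ 5 := by
  let x : EuclideanSpace ℝ (Option (Fin 5)) :=
    WithLp.toLp 2 fun o => o.elim (-(√3 / 3)) ![1, 0, 0, 0, 0]
  let f : MvPolynomial (Option (Fin 5)) ℝ := X none * (X (some 0) ^ 2 - X (some 1) ^ 2) ^ 2
  have hf (v : EuclideanSpace ℝ (Option (Fin 5))) :
      eval v.ofLp f = v none * (v (some 0) ^ 2 - v (some 1) ^ 2) ^ 2 := by simp [f]
  have horbit (g : OrthGroup 6) (hg : g ∈ G) : eval (u.repr (g (u.repr.symm x))).ofLp f ≤ 0 := by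
    obtain ⟨s, hs, hr, hnorm⟩ := h.exists_repr_apply_eq (x := x)
      (fun i => ⟨![1, 0, 0, 0, 0] i, by fin_cases i <;> simp [x]⟩)
      ⟨0, by
        simpa [x, Fin.sum_univ_succ] using
          (by norm_num [mul_div_assoc'] : -(√(5 - 2 : ℝ) * (√3 / 3)) + 1 = 0)⟩ hg rfl
    rw [hf]
    refine mul_sq_sub_sq_nonpos_of_half_integers ?_ hr (hnorm.trans ?_)
    · rw [hs]
      norm_num [x]
      ring
    · simpa [x, Fin.sum_univ_succ, div_pow] using (by norm_num : (3 / 3 ^ 2 + 1 : ℝ) = 4 / 3)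
  refine h.totalDegree_le hπ (by norm_num) (f := f) ?_ (norm_neg x).symm horbit (fun g hg => ?_)
    ?_ hi
  · exact (isHomogeneous_X ℝ _).mul
      ((((isHomogeneous_X ℝ _).pow 2).sub ((isHomogeneous_X ℝ _).pow 2)).pow 2)
  · have := horbit g hg
    rw [hf] at this ⊢
    simpa using this
  · rw [hf, hf]
    norm_num [x]

/-- `x` is a root, and the test polynomial is a square that vanishes at all roots. -/
theorem totalDegree_le_six {G : Subgroup (OrthGroup 7)} {b : Module.Basis (Fin 7) ℝ (EucSpace 7)}
    {u : OrthonormalBasis (Option (Fin 6)) ℝ (EucSpace 7)} (h : IsFrameE (k := 3) G b u)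
    {π : Fin 7 → MvPolynomial (Fin 7) ℝ} (hπ : IsBasicInvariants G π) {i : Fin 7}
    (hi : (i : ℕ) < 2) : (π i).totalDegree ≤ 6 := by
  let x : EuclideanSpace ℝ (Option (Fin 6)) :=
    WithLp.toLp 2 fun o => o.elim 0 ![1, 1, 0, 0, 0, 0]
  let y : EuclideanSpace ℝ (Option (Fin 6)) :=
    WithLp.toLp 2 fun o => o.elim 1 ![1, 0, 0, 0, 0, 0]
  let f : MvPolynomial (Option (Fin 6)) ℝ := (X none * (X (some 0) ^ 2 - X (some 1) ^ 2)) ^ 2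
  have hf (v : EuclideanSpace ℝ (Option (Fin 6))) :
      eval v.ofLp f = (v none * (v (some 0) ^ 2 - v (some 1) ^ 2)) ^ 2 := by simp [f]
  refine h.totalDegree_le hπ (by norm_num) (f := f) (x := x) (y := y) ?_ ?_ (fun g hg => ?_)
    (fun _ _ => ?_) ?_ hi
  · exact ((isHomogeneous_X ℝ _).mul
      (((isHomogeneous_X ℝ _).pow 2).sub ((isHomogeneous_X ℝ _).pow 2))).pow 2
  · simp [EuclideanSpace.norm_eq, x, y, Fintype.sum_option, Fin.sum_univ_succ]
  · obtain ⟨s, hs, hr, hnorm⟩ := h.exists_repr_apply_eq (x := x)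
      (fun i => ⟨![1, 1, 0, 0, 0, 0] i, by fin_cases i <;> simp [x]⟩)
      ⟨1, by simp [x, Fin.sum_univ_succ, one_add_one_eq_two]⟩ hg rfl
    rw [hf, mul_sq_sub_sq_eq_zero_of_half_integers (hs.trans (by norm_num [x])) hr
      (hnorm.trans (by simp [x, Fin.sum_univ_succ, one_add_one_eq_two]))]
    norm_num
  · rw [hf]
    positivity
  · rw [hf, hf]
    simp [x, y]

theorem totalDegree_le_eight {G : Subgroup (OrthGroup 8)} {b : Module.Basis (Fin 8) ℝ (EucSpace 8)}
    {u : OrthonormalBasis (Option (Fin 7)) ℝ (EucSpace 8)} (h : IsFrameE (k := 4) G b u)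
    {π : Fin 8 → MvPolynomial (Fin 8) ℝ} (hπ : IsBasicInvariants G π) {i : Fin 8}
    (hi : (i : ℕ) < 2) : (π i).totalDegree ≤ 8 := by
  let x : EuclideanSpace ℝ (Option (Fin 7)) :=
    WithLp.toLp 2 fun o => o.elim 0 ![1, 1, 0, 0, 0, 0, 0]
  let y : EuclideanSpace ℝ (Option (Fin 7)) :=
    WithLp.toLp 2 fun o => o.elim (4 / 5) ![1, 0, 3 / 5, 0, 0, 0, 0]
  let f : MvPolynomial (Option (Fin 7)) ℝ :=
    (X none * X (some 2) * (X (some 0) ^ 2 - X (some 1) ^ 2)) ^ 2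
  have hf (v : EuclideanSpace ℝ (Option (Fin 7))) :
      eval v.ofLp f = (v none * v (some 2) * (v (some 0) ^ 2 - v (some 1) ^ 2)) ^ 2 := by simp [f]
  refine h.totalDegree_le hπ (by norm_num) (f := f) (x := x) (y := y) ?_ ?_ (fun g hg => ?_)
    (fun _ _ => ?_) ?_ hi
  · exact (((isHomogeneous_X ℝ _).mul (isHomogeneous_X ℝ _)).mul
      (((isHomogeneous_X ℝ _).pow 2).sub ((isHomogeneous_X ℝ _).pow 2))).pow 2
  · simpa [EuclideanSpace.norm_eq, x, y, Fintype.sum_option, Fin.sum_univ_succ] using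
      congrArg Real.sqrt (by norm_num : (1 + 1 : ℝ) = (4 / 5) ^ 2 + (1 + (3 / 5) ^ 2))
  · obtain ⟨s, hs, hr, hnorm⟩ := h.exists_repr_apply_eq (x := x)
      (fun i => ⟨![1, 1, 0, 0, 0, 0, 0] i, by fin_cases i <;> simp [x]⟩)
      ⟨1, by simp [x, Fin.sum_univ_succ, one_add_one_eq_two]⟩ hg rfl
    rw [hf, mul_mul_sq_sub_sq_eq_zero_of_half_integers (hs.trans (by norm_num [x])) hr
      (hnorm.trans (by simp [x, Fin.sum_univ_succ, one_add_one_eq_two]))]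
    norm_num
  · rw [hf]
    positivity
  · rw [hf, hf]
    simpa [x, y] using (by norm_num : (0 : ℝ) < (4 / 5 * (3 / 5)) ^ 2)

end IsFrameE

end TestPolynomials

theorem proposition4p1 (n : ℕ) (hn : 6 ≤ n) (hn' : n ≤ 8)
    (G : Subgroup (OrthGroup n)) (hG : IsTypeE G)
    (X : Set (EucSpace n)) (hX : IsSparse G 2 X) (hne : X.Nonempty) :
    (X ∩ stratum G (n - 2)).Nonempty := by
  interval_cases n
  · obtain ⟨b, u, h⟩ := exists_isFrameE_two hG
    exact h.isFrameD.inter_stratum_nonempty (k := 2) one_le_two (by simp)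
      (fun π hπ i hi => h.totalDegree_le_five hπ hi) hX hne
  · obtain ⟨b, u, h⟩ := exists_isFrameE_three hG
    exact h.isFrameD.inter_stratum_nonempty (k := 3) (by norm_num) (by simp)
      (fun π hπ i hi => (h.totalDegree_le_six hπ hi).trans (by norm_num)) hX hne
  · obtain ⟨b, u, h⟩ := exists_isFrameE_four hG
    exact h.isFrameD.inter_stratum_nonempty (k := 4) (by norm_num) (by simp)
      (fun π hπ i hi => (h.totalDegree_le_eight hπ hi).trans (by norm_num)) hX hne
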